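/- Let $k\ge 1$ and $n_1,\dots,n_k\ge 2$ be integers. For each $i$ let $H_{n_i}$ be an $n_i$-dimensional complex Hilbert space, $F^2(H_{n_i})=\mathbb C\oplus\bigoplus_{p\ge1}H_{n_i}^{\otimes p}$ its full Fock space with the orthonormal basis $\{e^i_\alpha\}$ indexed by the words $\alpha$ of the free monoid $\mathbb F_{n_i}^+$ on $g^i_1,\dots,g^i_{n_i}$, and write $|\alpha|$ for the length of $\alpha$. On $F:=F^2(H_{n_1})\otimes\cdots\otimes F^2(H_{n_k})$ let $\mathbf S_{i,j}$ be the isometry acting on the $i$-th tensor factor by $e^i_\alpha\mapsto e^i_{g^i_j\alpha}$ and as the identity on the other factors, let $P_{q_i}^{(i)}$ be the orthogonal projection of $F^2(H_{n_i})$ onto the span of the $e^i_\alpha$ with $|\alpha|=q_i$, and let $P_{\le(q_1,\dots,q_k)}$ be the orthogonal projection of $F$ onto the span of all $e^1_{\alpha_1}\otimes\cdots\otimes e^k_{\alpha_k}$ with $|\alpha_i|\le q_i$. For a tuple $\mathbf T=(T_{i,j})_{1\le i\le k,\,1\le j\le n_i}$ of bounded operators on a Hilbert space $\mathcal H$ put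 $\Phi_{T_i}(Y)=\sum_{j}T_{i,j}YT_{i,j}^*$, $\mathbf\Delta^{\mathbf p}_{\mathbf T}=(\mathrm{id}-\Phi_{T_1})^{p_1}\circ\cdots\circ(\mathrm{id}-\Phi_{T_k})^{p_k}$ for $\mathbf p\in\{0,1\}^k$, $\mathbf\Delta_{\mathbf T}=\mathbf\Delta_{\mathbf T}^{(1,\dots,1)}$, and $T_{i,\alpha}=T_{i,j_1}\cdots T_{i,j_p}$ for $\alpha=g^i_{j_1}\cdots g^i_{j_p}$. The tuple is in the regular polyball $\mathbf B_{\mathbf n}(\mathcal H)$ if $T_{s,a}T_{t,b}=T_{t,b}T_{s,a}$ whenever $s\ne t$ and $\mathbf\Delta_{\mathbf T}^{\mathbf p}(I)\ge0$ for all $\mathbf p\in\{0,1\}^k$; it has finite rank defect if $\mathbf\Delta_{\mathbf T}(I)$ has finite rank. For such $\mathbf T$, with Berezin kernel $$\mathbf K_{\mathbf T}h=\sum_{\beta_1,\dots,\beta_k}e^1_{\beta_1}\otimes\cdots\otimes e^k_{\beta_k}\otimes\mathbf\Delta_{\mathbf T}(I)^{1/2}T_{1,\beta_1}^*\cdots T_{k,\beta_k}^*h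 ,$$ define $$\mathrm{curv}(\mathbf T)=\lim_{m\to\infty}\frac1{\binom{m+k}{k}}\sum_{\substack{q_1,\dots,q_k\ge0\\ q_1+\cdots+q_k\le m}}\frac{\mathrm{trace}\,[\mathbf K_{\mathbf T}^*(P^{(1)}_{q_1}\otimes\cdots\otimes P^{(k)}_{q_k}\otimes I)\mathbf K_{\mathbf T}]}{\mathrm{trace}\,[P^{(1)}_{q_1}\otimes\cdots\otimes P^{(k)}_{q_k}]},$$ $$\chi(\mathbf T)=\lim_{m\to\infty}\frac{\dim\,\mathrm{span}\{T_{1,\alpha_1}\cdots T_{k,\alpha_k}h:\ |\alpha_i|\le q^{(m)}_i,\ h\in\mathbf\Delta_{\mathbf T}(I)(\mathcal H)\}}{\prod_{i=1}^k(1+n_i+\cdots+n_i^{q_i^{(m)}})},$$ where $(\mathbf q^{(m)})$ is an increasing cofinal sequence in $\mathbb Z_+^k$ (existence of $\chi(\mathbf T)$ meaning that the limit exists and is the same for all such sequences). Theorem. Let $\mathcal M\subseteq F$ be a closed subspace that is invariant under all $\mathbf S_{i,j}$ and graded, i.e. $U(\lambda)\mathcal M\subseteq\mathcal M$ for all $\lambda\in\mathbb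 T^k$, where $U(\lambda)(e^1_{\alpha_1}\otimes\cdots\otimes e^k_{\alpha_k})=\lambda_1^{|\alpha_1|}\cdots\lambda_k^{|\alpha_k|}\,e^1_{\alpha_1}\otimes\cdots\otimes e^k_{\alpha_k}$. Let $P_{\mathcal M^\perp}\mathbf S|_{\mathcal M^\perp}$ be the compression of $\mathbf S=(\mathbf S_{i,j})$ to $\mathcal M^\perp$. Then this compression is in $\mathbf B_{\mathbf n}(\mathcal M^\perp)$ and has finite rank defect, all the limits below exist, and $$\lim_{q_1\to\infty}\cdots\lim_{q_k\to\infty}\frac{\mathrm{rank}\,[P_{\mathcal M^\perp}P_{\le(q_1,\dots,q_k)}]}{\mathrm{rank}\,[P_{\le(q_1,\dots,q_k)}]}=\lim_{q_1\to\infty}\cdots\lim_{q_k\to\infty}\frac{\mathrm{trace}\,[P_{\mathcal M^\perp}P_{\le(q_1,\dots,q_k)}]}{\mathrm{trace}\,[P_{\le(q_1,\dots,q_k)}]}.$$ Moreover, the left-hand side equals $\chi(P_{\mathcal M^\perp}\mathbf S|_{\mathcal M^\perp})$ and the right-hand side equals $\mathrm{curv}(P_{\mathcal M^\perp}\mathbf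 S|_{\mathcal M^\perp})$, so that the identity is equivalent to $$\chi(P_{\mathcal M^\perp}\mathbf S|_{\mathcal M^\perp})=\mathrm{curv}(P_{\mathcal M^\perp}\mathbf S|_{\mathcal M^\perp}).$$ -/

import Mathlib

open Filter Topology

noncomputable section

namespace Polyball

/-! ### Tuples of operators on a Hilbert space -/

section Tuples

variable {k : ℕ} {n : Fin k → ℕ}
variable {H : Type*} [NormedAddCommGroup H] [InnerProductSpace ℂ H] [CompleteSpace H]

/-- The direct product `𝔽_{n₁}⁺ × ⋯ × 𝔽_{n_k}⁺` of free semigroups with identity. -/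
abbrev Words (n : Fin k → ℕ) : Type := ∀ i : Fin k, FreeMonoid (Fin (n i))

/-- The multi-degree `(|α₁|, …, |α_k|)`. -/
def deg (α : Words n) : Fin k → ℕ := fun i => (α i).length

/-- A family `X = (X₁, …, X_k)`, `X_i = (X_{i,1}, …, X_{i,n_i})`, of bounded operators on `H`. -/
abbrev Tuple (n : Fin k → ℕ) (H : Type*) [NormedAddCommGroup H] [InnerProductSpace ℂ H] :=
  ∀ i : Fin k, Fin (n i) → (H →L[ℂ] H)

/-- `Φ_{X_i}(Y) = ∑_j X_{i,j} Y X_{i,j}^*`. -/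
def Phi (X : Tuple n H) (i : Fin k) : Module.End ℂ (H →L[ℂ] H) where
  toFun Y := ∑ j, X i j * Y * star (X i j)
  map_add' Y Z := by simp only [mul_add, add_mul, Finset.sum_add_distrib]
  map_smul' c Y := by
    simp only [mul_smul_comm, smul_mul_assoc, Finset.smul_sum, RingHom.id_apply]

/-- `Δ_X^p(I) = (id - Φ_{X_1})^{p_1} ∘ ⋯ ∘ (id - Φ_{X_k})^{p_k} (I)`. -/
def defectPow (X : Tuple n H) (p : Fin k → ℕ) : H →L[ℂ] H :=
  (List.ofFn fun i => (1 - Phi X i) ^ p i).prod 1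

/-- The defect operator `Δ_X(I) = (id - Φ_{X_1}) ∘ ⋯ ∘ (id - Φ_{X_k}) (I)`. -/
def defect (X : Tuple n H) : H →L[ℂ] H := defectPow X fun _ => 1

/-- The regular polyball `B_n(H)`. -/
structure InPolyball (X : Tuple n H) : Prop where
  commute : ∀ s t : Fin k, s ≠ t → ∀ a b, Commute (X s a) (X t b)
  positive : ∀ p : Fin k → ℕ, (∀ i, p i ≤ 1) → (defectPow X p).IsPositive

/-- `X` has finite rank defect. -/
def HasFiniteRankDefect (X : Tuple n H) : Prop :=
  FiniteDimensional ℂ (LinearMap.range (defect X).toLinearMap)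

/-- `X_{i,β} = X_{i,j₁} ⋯ X_{i,j_p}` for the word `β = g_{j₁} ⋯ g_{j_p}`. -/
def wordOp (X : Tuple n H) (i : Fin k) (β : FreeMonoid (Fin (n i))) : H →L[ℂ] H :=
  FreeMonoid.lift (X i) β

/-- `M_q(X) = span {X_{1,α₁} ⋯ X_{k,α_k} h : |α_i| ≤ q_i, h ∈ Δ_X(I)(H)}`. -/
def degSpan (X : Tuple n H) (q : Fin k → ℕ) : Submodule ℂ H :=
  Submodule.span ℂ {x | ∃ α : Words n, deg α ≤ q ∧
    ∃ h, x = (List.ofFn fun i => wordOp X i (α i)).prod (defect X h)}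

/-- `χ(X)` exists and equals `x`: for every increasing cofinal sequence `q^{(m)}` in `ℤ₊^k`,
`dim M_{q^{(m)}}(X) / ∏_i (1 + n_i + ⋯ + n_i^{q_i^{(m)}})` tends to `x`. -/
def HasEulerCharacteristic (X : Tuple n H) (x : ℝ) : Prop :=
  ∀ q : ℕ → (Fin k → ℕ), Monotone q → (∀ p, ∃ m, p ≤ q m) →
    Tendsto (fun m => (Module.finrank ℂ (degSpan X (q m)) : ℝ) /
      ∏ i, ∑ s ∈ Finset.range (q m i + 1), (n i : ℝ) ^ s) atTop (𝓝 x)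

/-- The rank of an operator of finite rank. -/
def opRank (A : H →L[ℂ] H) : ℕ := Module.finrank ℂ (LinearMap.range A.toLinearMap)

/-- The trace `∑_b ⟨b, A b⟩` over an orthonormal basis of `H`; for a trace class operator (in
particular, one of finite rank) the choice of the basis does not matter. -/
def opTrace (A : H →L[ℂ] H) : ℂ :=
  ∑' b : (exists_hilbertBasis ℂ H).choose, inner ℂ (b : H) (A b)

/-! ### Tensor products of full Fock spaces -/

/-- `F²(H_{n₁}) ⊗ ⋯ ⊗ F²(H_{n_k}) ⊗ G`, written in coordinates: `F²(H_{n_i})` has the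
orthonormal basis `e^i_β`, `β ∈ 𝔽_{n_i}⁺`, so an element of the Hilbert tensor product is a
square summable family of vectors of `G` indexed by `α = (α₁, …, α_k)`, the `α`-th one being the
coefficient of `e_α = e^1_{α₁} ⊗ ⋯ ⊗ e^k_{α_k}`. -/
abbrev FockTensor (n : Fin k → ℕ) (G : Type*) [NormedAddCommGroup G] : Type _ :=
  lp (fun _ : Words n => G) 2

/-- `F²(H_{n₁}) ⊗ ⋯ ⊗ F²(H_{n_k})`. -/
abbrev Fock (n : Fin k → ℕ) : Type := FockTensor n ℂ

/-- The orthonormal basis `e_α = e^1_{α₁} ⊗ ⋯ ⊗ e^k_{α_k}` of `F²(H_{n₁}) ⊗ ⋯ ⊗ F²(H_{n_k})`. -/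
def e (n : Fin k → ℕ) : HilbertBasis (Words n) ℂ (Fock n) := ⟨LinearIsometryEquiv.refl ℂ _⟩

/-- `P_A ⊗ I_G`, where `P_A` is the orthogonal projection onto the closed span of the `e_α`,
`α ∈ A`: the orthogonal projection onto the closed span of the `e_α ⊗ g`, `α ∈ A`, `g ∈ G`. -/
def wordProj (G : Type*) [NormedAddCommGroup G] [InnerProductSpace ℂ G] [CompleteSpace G]
    (A : Set (Words n)) : FockTensor n G →L[ℂ] FockTensor n G :=
  (Submodule.span ℂ {f : FockTensor n G | ∃ α ∈ A, ∀ β, β ≠ α → f β = 0}).topologicalClosure.starProjection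

/-- `P_{q₁}^{(1)} ⊗ ⋯ ⊗ P_{q_k}^{(k)} ⊗ I_G`. -/
def projEq (n : Fin k → ℕ) (G : Type*) [NormedAddCommGroup G] [InnerProductSpace ℂ G]
    [CompleteSpace G] (q : Fin k → ℕ) : FockTensor n G →L[ℂ] FockTensor n G :=
  wordProj G {α | deg α = q}

/-- `P_{≤ (q₁, …, q_k)} ⊗ I_G`. -/
def projLE (n : Fin k → ℕ) (G : Type*) [NormedAddCommGroup G] [InnerProductSpace ℂ G]
    [CompleteSpace G] (q : Fin k → ℕ) : FockTensor n G →L[ℂ] FockTensor n G :=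
  wordProj G {α | deg α ≤ q}

/-- Left concatenation by `g_j` in the `i`-th word. -/
def consWord (i : Fin k) (j : Fin (n i)) (α : Words n) : Words n :=
  Function.update α i (FreeMonoid.of j * α i)

lemma consWord_injective (i : Fin k) (j : Fin (n i)) :
    Function.Injective (consWord (n := n) i j) := by
  intro α β h
  funext l
  have hl := congrFun h l
  by_cases hli : l = i
  · subst hli
    simpa [consWord] using hl
  · simpa [consWord, hli] using hl

/-- The universal model: `S_{i,j} = I ⊗ ⋯ ⊗ S_{i,j} ⊗ ⋯ ⊗ I`, the isometry that maps `e_α` to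
`e^1_{α₁} ⊗ ⋯ ⊗ e^i_{g_j α_i} ⊗ ⋯ ⊗ e^k_{α_k}`. -/
def S (n : Fin k → ℕ) : Tuple n (Fock n) := fun i j =>
  (((e n).orthonormal.comp _ (consWord_injective i j)).orthogonalFamily.linearIsometry
    ).toContinuousLinearMap

lemma S_apply_e (i : Fin k) (j : Fin (n i)) (α : Words n) :
    S n i j (e n α) = e n (consWord i j α) := by
  classical
  nth_rewrite 1 [← HilbertBasis.repr_symm_single (e n) α]
  exact (((e n).orthonormal.comp _
    (consWord_injective i j)).orthogonalFamily.linearIsometry_apply_single (1 : ℂ)).trans (by simp)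

lemma orthonormal_gauge (z : Fin k → Circle) :
    Orthonormal ℂ fun α : Words n => ((∏ i, z i ^ (α i).length : Circle) : ℂ) • e n α := by
  refine ⟨fun α => by rw [norm_smul, (e n).orthonormal.1 α, Circle.norm_coe, one_mul], fun α β h => ?_⟩
  simp only [inner_smul_left, inner_smul_right, (e n).orthonormal.2 h, mul_zero]

/-- The canonical gauge group: `U(z) e_α = z₁^{|α₁|} ⋯ z_k^{|α_k|} e_α` for `z ∈ 𝕋^k`. -/
def gauge (n : Fin k → ℕ) (z : Fin k → Circle) : Fock n →L[ℂ] Fock n :=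
  (orthonormal_gauge (n := n) z).orthogonalFamily.linearIsometry.toContinuousLinearMap

lemma gauge_apply_e (z : Fin k → Circle) (α : Words n) :
    gauge n z (e n α) = ((∏ i, z i ^ (α i).length : Circle) : ℂ) • e n α := by
  classical
  nth_rewrite 1 [← HilbertBasis.repr_symm_single (e n) α]
  exact ((orthonormal_gauge z).orthogonalFamily.linearIsometry_apply_single (1 : ℂ)).trans (by simp)

/-- `M` is a (closed) invariant subspace of `F²(H_{n₁}) ⊗ ⋯ ⊗ F²(H_{n_k})`. -/
structure IsInvariantSubspace (M : Submodule ℂ (Fock n)) : Prop where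
  isClosed : IsClosed (M : Set (Fock n))
  invariant : ∀ (i : Fin k) (j : Fin (n i)), ∀ f ∈ M, S n i j f ∈ M

/-- `M` is graded with respect to the canonical gauge group. -/
def IsGraded (M : Submodule ℂ (Fock n)) : Prop :=
  ∀ z : Fin k → Circle, ∀ f ∈ M, gauge n z f ∈ M

/-- The compression `P_{M⊥} S|_{M⊥}` of the universal model to the orthocomplement of `M`. -/
def compression (M : Submodule ℂ (Fock n)) : Tuple n Mᗮ := fun i j =>
  Mᗮ.orthogonalProjectionOnto ∘L S n i j ∘L Mᗮ.subtypeL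

/-! ### The Berezin kernel and the curvature -/

/-- `K` is the Berezin kernel of `X`, that is,
`K h = ∑_β e_β ⊗ Δ_X(I)^{1/2} X_{1,β₁}^* ⋯ X_{k,β_k}^* h`. -/
def IsBerezinKernel (X : Tuple n H) (K : H →L[ℂ] FockTensor n H) : Prop :=
  ∀ (h : H) (β : Words n),
    K h β = CFC.sqrt (defect X) ((List.ofFn fun i => star (wordOp X i (β i))).prod h)

open Classical in
/-- The noncommutative Berezin kernel `K_X`; it exists as a contraction when `X` lies in the
regular polyball (and is `0` by convention if the defining series gives no bounded operator). -/
def berezinKernel (X : Tuple n H) : H →L[ℂ] FockTensor n H :=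
  if hK : ∃ K, IsBerezinKernel X K then hK.choose else 0

/-- `trace [K_X^* (P_{q₁} ⊗ ⋯ ⊗ P_{q_k} ⊗ I) K_X] / trace [P_{q₁} ⊗ ⋯ ⊗ P_{q_k}]`. -/
def curvatureTerm (X : Tuple n H) (q : Fin k → ℕ) : ℂ :=
  opTrace ((berezinKernel X).adjoint ∘L projEq n H q ∘L berezinKernel X) /
    opTrace (projEq n ℂ q)

/-- `curv(X)` exists and equals `c`: the average of the terms above over all `q ∈ ℤ₊^k` with
`q₁ + ⋯ + q_k ≤ m` (there are `binom (m + k) k` of them) tends to `c` as `m → ∞`. -/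
def HasCurvature (X : Tuple n H) (c : ℝ) : Prop :=
  Tendsto (fun m : ℕ => (1 / ((m + k).choose k : ℂ)) *
      ∑ q ∈ (Finset.Iic fun _ : Fin k => m) with ∑ i, q i ≤ m, curvatureTerm X q)
    atTop (𝓝 (c : ℂ))

end Tuples

/-! ### Iterated limits -/

/-- The iterated limit `lim_{q₁ → ∞} ⋯ lim_{q_k → ∞} f(q₁, …, q_k)` exists (each of the
successive limits does) and equals `L`. -/
def HasIteratedLimit {E : Type*} [TopologicalSpace E] :
    (k : ℕ) → ((Fin k → ℕ) → E) → E → Prop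
  | 0, f, L => f Fin.elim0 = L
  | k + 1, f, L => ∃ g : ℕ → E,
      (∀ m : ℕ, HasIteratedLimit k (fun q => f (Fin.cons m q)) (g m)) ∧ Tendsto g atTop (𝓝 L)

end Polyball

end

open Filter Topology

noncomputable section

namespace Polyball

/-! ### Averages of antitone families -/

/-! Gradedness makes `M` invariant under each homogeneous projection, so `Mᗮ` splits by
multi-degree. Let `homRatio M q` be the dimension of its degree `q` component relative to that of
the Fock space. Since `Mᗮ` is invariant under the adjoints of the `S n i j`, the map `f ↦ (S_{i,j}^*
f)_j` embeds the component of degree `q + e_i` into `n i` copies of the component of degree `q`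
(`homDim_add_single_le`). Hence `homRatio M` is antitone on `ℤ₊^k`; let `c` be its infimum.

All the quantities are averages of this one function. The rank and trace quotients are its averages
over the box `{p | p ≤ q}` with product weights `n_i ^ p_i`; rank and trace agree because a product
of commuting projections is a projection. The defect of the compression is the compressed vacuum
projection, so the spaces defining `χ` are the ranges of `P_{Mᗮ} P_{≤ q}`
(`map_degSpan_compression`), with the same box averages. The Berezin kernel preserves inner products
coordinate by coordinate, so the `q`-th curvature term is exactly `homRatio M q`
(`curvatureTerm_compression`), and `curv` is the limit of its uniform averages over simplices.

Averages of an antitone function tend to its infimum once their mass escapes into every upper set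
`{p | p₀ ≤ p}` (`tendsto_weighted_sum`). Boxes and simplices both have this property, so every limit
is `c`. -/

/-- Weighted averages of an antitone family converge to its infimum as soon as the weights
concentrate on every upper set `{p | p₀ ≤ p}`. -/
lemma tendsto_weighted_sum {P J : Type*} [Preorder P] [OrderBot P] {l : Filter J} {x : P → ℝ}
    {c : ℝ} (hx : Antitone x) (hc : IsGLB (Set.range x) c) (s : J → Finset P) (v : J → P → ℝ)
    (hv : ∀ j p, 0 ≤ v j p) (hv1 : ∀ᶠ j in l, ∑ p ∈ s j, v j p = 1) (t : P → J → Finset P)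
    (hts : ∀ p₀ j, t p₀ j ⊆ s j) (ht : ∀ p₀ j, ∀ p ∈ t p₀ j, p₀ ≤ p)
    (hmass : ∀ p₀, Tendsto (fun j => ∑ p ∈ t p₀ j, v j p) l (𝓝 1)) :
    Tendsto (fun j => ∑ p ∈ s j, v j p * x p) l (𝓝 c) := by
  classical
  have hxc : ∀ p, c ≤ x p := fun p => hc.1 ⟨p, rfl⟩
  rw [Metric.tendsto_nhds]
  intro ε hε
  obtain ⟨p₀, hp₀⟩ : ∃ p₀, x p₀ < c + ε / 2 := by
    obtain ⟨_, ⟨p₀, rfl⟩, _, h⟩ := hc.exists_between (show c < c + ε / 2 by linarith)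
    exact ⟨p₀, h⟩
  have hlim : Tendsto (fun j => (x ⊥ - c) * (1 - ∑ p ∈ t p₀ j, v j p)) l (𝓝 0) := by
    simpa using ((hmass p₀).const_sub 1).const_mul (x ⊥ - c)
  filter_upwards [hv1, hlim.eventually (gt_mem_nhds (half_pos hε))] with j h1 h2
  -- The error splits in two: on `t p₀ j` each term has `x p - c < ε / 2`, and off it the crude
  -- bound `x ⊥ - c` is multiplied by a vanishing mass.
  have hsplit : ∑ p ∈ s j, v j p * x p - c = ∑ p ∈ s j, v j p * (x p - c) := by
    simp only [mul_sub, Finset.sum_sub_distrib, ← Finset.sum_mul, h1, one_mul]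
  have hmass1 : ∑ p ∈ s j \ t p₀ j, v j p = 1 - ∑ p ∈ t p₀ j, v j p := by
    rw [← h1, ← Finset.sum_sdiff (hts p₀ j)]; ring
  have hle : ∑ p ∈ t p₀ j, v j p ≤ 1 := by
    rw [← h1]; exact Finset.sum_le_sum_of_subset_of_nonneg (hts p₀ j) fun p _ _ => hv j p
  have hA : ∑ p ∈ t p₀ j, v j p * (x p - c) ≤ ε / 2 := by
    calc ∑ p ∈ t p₀ j, v j p * (x p - c) ≤ ∑ p ∈ t p₀ j, v j p * (ε / 2) :=
          Finset.sum_le_sum fun p hp => mul_le_mul_of_nonneg_left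
            (by have := hx (ht p₀ j p hp); linarith) (hv j p)
      _ ≤ ε / 2 := by rw [← Finset.sum_mul]; nlinarith
  have hB : ∑ p ∈ s j \ t p₀ j, v j p * (x p - c) ≤ (x ⊥ - c) * (1 - ∑ p ∈ t p₀ j, v j p) := by
    rw [← hmass1, Finset.mul_sum]
    refine Finset.sum_le_sum fun p _ => ?_
    rw [mul_comm]
    exact mul_le_mul_of_nonneg_right (by have := hx (bot_le (a := p)); linarith) (hv j p)
  have h0 : 0 ≤ ∑ p ∈ s j, v j p * (x p - c) :=
    Finset.sum_nonneg fun p _ => mul_nonneg (hv j p) (sub_nonneg.2 (hxc p))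
  rw [Real.dist_eq, hsplit, abs_of_nonneg h0, ← Finset.sum_sdiff (hts p₀ j)]
  linarith

/-- The average of `x` over the box `{p | p ≤ q}` with respect to product weights. -/
def boxAverage {k : ℕ} (w : Fin k → ℕ → ℝ) (x : (Fin k → ℕ) → ℝ) (q : Fin k → ℕ) : ℝ :=
  (∑ p ∈ Finset.Iic q, (∏ i, w i (p i)) * x p) / ∏ i, ∑ s ∈ Finset.range (q i + 1), w i s

/-- The omitted initial segment has fixed weight, while weights at least `1` make the total diverge.
-/
lemma tendsto_sum_Icc_div {w : ℕ → ℝ} (hw : ∀ s, 1 ≤ w s) (a : ℕ) :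
    Tendsto (fun m => (∑ s ∈ Finset.Icc a m, w s) / ∑ s ∈ Finset.range (m + 1), w s) atTop
      (𝓝 1) := by
  have hW : Tendsto (fun m => ∑ s ∈ Finset.range (m + 1), w s) atTop atTop := by
    refine tendsto_atTop_mono (f := fun m : ℕ => (m : ℝ)) (fun m => ?_) tendsto_natCast_atTop_atTop
    calc (m : ℝ) ≤ ∑ s ∈ Finset.range (m + 1), (1 : ℝ) := by simp
      _ ≤ _ := Finset.sum_le_sum fun s _ => hw s
  have h := (tendsto_const_nhds (x := ∑ s ∈ Finset.range a, w s)).div_atTop hW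
  have h' := h.const_sub 1
  rw [sub_zero] at h'
  refine h'.congr' ?_
  filter_upwards [eventually_ge_atTop a] with m hm
  have hpos : 0 < ∑ s ∈ Finset.range (m + 1), w s :=
    Finset.sum_pos (fun s _ => by have := hw s; linarith) ⟨0, by simp⟩
  have : ∑ s ∈ Finset.range (m + 1), w s
      = ∑ s ∈ Finset.range a, w s + ∑ s ∈ Finset.Icc a m, w s := by
    rw [← Finset.sum_range_add_sum_Ico _ (show a ≤ m + 1 by omega)]; rfl
  field_simp
  linarith

lemma sum_Icc_prod {k : ℕ} (w : Fin k → ℕ → ℝ) (a b : Fin k → ℕ) :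
    ∑ p ∈ Finset.Icc a b, ∏ i, w i (p i) = ∏ i, ∑ s ∈ Finset.Icc (a i) (b i), w i s := by
  rw [Finset.prod_univ_sum]; rfl

lemma sum_Iic_prod {k : ℕ} (w : Fin k → ℕ → ℝ) (b : Fin k → ℕ) :
    ∑ p ∈ Finset.Iic b, ∏ i, w i (p i) = ∏ i, ∑ s ∈ Finset.range (b i + 1), w i s := by
  have : Finset.Iic b = Finset.Icc 0 b := by ext p; simp
  rw [this, sum_Icc_prod]
  refine Finset.prod_congr rfl fun i _ => Finset.sum_congr ?_ fun _ _ => rfl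
  ext s; simp

lemma prod_sum_range_pos {k : ℕ} {w : Fin k → ℕ → ℝ} (hw : ∀ i s, 1 ≤ w i s) (q : Fin k → ℕ) :
    0 < ∏ i, ∑ s ∈ Finset.range (q i + 1), w i s :=
  Finset.prod_pos fun i _ =>
    Finset.sum_pos (fun s _ => by have := hw i s; linarith) ⟨0, by simp⟩

/-- Product weights factor, so the mass of `{p | p₀ ≤ p ≤ q}` is a product of one-variable ratios,
each tending to `1`. Convergence along `atTop` on `ℤ₊^k` covers every cofinal monotone sequence at
once, as `χ` requires. -/
lemma tendsto_boxAverage {k : ℕ} {w : Fin k → ℕ → ℝ} (hw : ∀ i s, 1 ≤ w i s)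
    {x : (Fin k → ℕ) → ℝ} {c : ℝ} (hx : Antitone x) (hc : IsGLB (Set.range x) c) :
    Tendsto (boxAverage w x) atTop (𝓝 c) := by
  have h := tendsto_weighted_sum (l := atTop) hx hc (fun q : Fin k → ℕ => Finset.Iic q)
    (fun q p => (∏ i, w i (p i)) / ∏ i, ∑ s ∈ Finset.range (q i + 1), w i s)
    (fun q p => div_nonneg (Finset.prod_nonneg fun i _ => by have := hw i (p i); linarith)
      (prod_sum_range_pos hw q).le)
    (Eventually.of_forall fun q => by
      rw [← Finset.sum_div, sum_Iic_prod, div_self (prod_sum_range_pos hw q).ne'])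
    (fun p₀ q => Finset.Icc p₀ q) (fun p₀ q => Finset.Icc_subset_Iic_self)
    (fun p₀ q p hp => (Finset.mem_Icc.1 hp).1)
    (fun p₀ => by
      simp_rw [← Finset.sum_div, sum_Icc_prod, ← Finset.prod_div_distrib]
      have : Tendsto (fun q : Fin k → ℕ => ∏ i, (∑ s ∈ Finset.Icc (p₀ i) (q i), w i s) /
          ∑ s ∈ Finset.range (q i + 1), w i s) atTop (𝓝 (∏ _i : Fin k, 1)) :=
        tendsto_finsetProd _ fun i _ => (tendsto_sum_Icc_div (hw i) (p₀ i)).comp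
          (tendsto_atTop.2 fun b => (eventually_ge_atTop fun _ => b).mono fun q hq => hq i)
      simpa using this)
  refine h.congr fun q => ?_
  rw [boxAverage, Finset.sum_div]
  exact Finset.sum_congr rfl fun p _ => by ring

lemma sum_Iic_cons {k : ℕ} {E : Type*} [AddCommMonoid E] (F : (Fin (k + 1) → ℕ) → E) (m : ℕ)
    (q : Fin k → ℕ) :
    ∑ p ∈ Finset.Iic (Fin.cons m q : Fin (k + 1) → ℕ), F p
      = ∑ l ∈ Finset.range (m + 1), ∑ p ∈ Finset.Iic q, F (Fin.cons l p) := by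
  rw [← Finset.sum_product']
  refine (Finset.sum_nbij' (fun y : ℕ × (Fin k → ℕ) => (Fin.cons y.1 y.2 : Fin (k + 1) → ℕ))
    (fun p => (p 0, Fin.tail p)) ?_ ?_ ?_ ?_ ?_).symm
  · rintro ⟨l, p⟩ h
    simp only [Finset.mem_product, Finset.mem_range, Finset.mem_Iic] at h
    simp only [Finset.mem_Iic, Fin.cons_le_cons]
    exact ⟨by omega, h.2⟩
  · intro p h
    rw [Finset.mem_Iic] at h
    simp only [Finset.mem_product, Finset.mem_range, Finset.mem_Iic]
    refine ⟨by have := h 0; simp only [Fin.cons_zero] at this; omega, fun i => ?_⟩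
    simpa [Fin.tail] using h i.succ
  · rintro ⟨l, p⟩ _; simp
  · intro p _; simp
  · rintro ⟨l, p⟩ _; rfl

/-- Fubini for product weights: with the first index fixed, a box average is a finite combination of
box averages of slices. This drives the induction for iterated limits. -/
lemma boxAverage_cons {k : ℕ} (w : Fin (k + 1) → ℕ → ℝ) (x : (Fin (k + 1) → ℕ) → ℝ) (m : ℕ)
    (q : Fin k → ℕ) :
    boxAverage w x (Fin.cons m q) = ∑ l ∈ Finset.range (m + 1),
      (w 0 l / ∑ s ∈ Finset.range (m + 1), w 0 s) *
        boxAverage (fun i => w i.succ) (fun p => x (Fin.cons l p)) q := by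
  simp only [boxAverage, sum_Iic_cons, Fin.prod_univ_succ, Fin.cons_zero, Fin.cons_succ,
    Finset.sum_div, Finset.mul_sum]
  refine Finset.sum_congr rfl fun l _ => Finset.sum_congr rfl fun p _ => ?_
  rw [div_mul_div_comm, mul_assoc]

lemma HasIteratedLimit.sum_mul {ι : Type*} (s : Finset ι) (a : ι → ℝ) :
    ∀ {k : ℕ} {f : ι → (Fin k → ℕ) → ℝ} {L : ι → ℝ}, (∀ l ∈ s, HasIteratedLimit k (f l) (L l)) →
      HasIteratedLimit k (fun q => ∑ l ∈ s, a l * f l q) (∑ l ∈ s, a l * L l)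
  | 0, _, _, h => Finset.sum_congr rfl fun l hl => congrArg (a l * ·) (h l hl)
  | _ + 1, _, _, h => by
    choose! g hg hgL using h
    exact ⟨fun m => ∑ l ∈ s, a l * g l m, fun m => HasIteratedLimit.sum_mul s a fun l hl => hg l hl m,
      tendsto_finsetSum _ fun l hl => (hgL l hl).const_mul _⟩

lemma HasIteratedLimit.ofReal :
    ∀ {k : ℕ} {f : (Fin k → ℕ) → ℝ} {L : ℝ}, HasIteratedLimit k f L →
      HasIteratedLimit k (fun q => (f q : ℂ)) (L : ℂ)
  | 0, _, _, h => congrArg Complex.ofReal h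
  | _ + 1, _, L, ⟨g, hg, hL⟩ =>
    ⟨fun m => g m, fun m => (hg m).ofReal, (Complex.continuous_ofReal.tendsto L).comp hL⟩

/-- The joint limit alone does not give existence of the inner limits. By induction, the slice at
first index `l` has averages tending to its infimum `y_l`; the sequence `y` is again antitone with
infimum `c`, so the outermost limit is a one-variable average of `y`. -/
lemma hasIteratedLimit_boxAverage : ∀ {k : ℕ} {w : Fin k → ℕ → ℝ}, (∀ i s, 1 ≤ w i s) →
    ∀ {x : (Fin k → ℕ) → ℝ} {c : ℝ}, Antitone x → IsGLB (Set.range x) c →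
      HasIteratedLimit k (boxAverage w x) c
  | 0, w, _, x, c, _, hc => by
    have h1 : boxAverage w x Fin.elim0 = x Fin.elim0 := by
      have : Finset.Iic (Fin.elim0 : Fin 0 → ℕ) = {Fin.elim0} := by
        ext p; simp [Subsingleton.elim p Fin.elim0]
      simp [boxAverage, this]
    have h2 : Set.range x = {x Fin.elim0} := by
      rw [Set.range_unique]; exact congrArg _ (congrArg x (Subsingleton.elim _ _))
    rw [h2] at hc
    exact h1.trans (isGLB_singleton.unique hc)
  | k + 1, w, hw, x, c, hx, hc => by
    have hbdd : ∀ l : ℕ, BddBelow (Set.range fun p : Fin k → ℕ => x (Fin.cons l p)) := fun l =>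
      ⟨c, by rintro _ ⟨p, rfl⟩; exact hc.1 ⟨_, rfl⟩⟩
    have hy : ∀ l : ℕ, IsGLB (Set.range fun p : Fin k → ℕ => x (Fin.cons l p))
        (⨅ p, x (Fin.cons l p)) := fun l => isGLB_ciInf (hbdd l)
    have hyanti : Antitone fun l : ℕ => ⨅ p : Fin k → ℕ, x (Fin.cons l p) := fun l l' hl =>
      ciInf_mono (hbdd l') fun p => hx (Fin.cons_le_cons.2 ⟨hl, le_rfl⟩)
    have hyc : IsGLB (Set.range fun l : ℕ => ⨅ p : Fin k → ℕ, x (Fin.cons l p)) c := by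
      refine ⟨?_, fun b hb => hc.2 ?_⟩
      · rintro _ ⟨l, rfl⟩
        exact le_ciInf fun p => hc.1 ⟨_, rfl⟩
      · rintro _ ⟨p, rfl⟩
        refine (hb ⟨p 0, rfl⟩).trans ((ciInf_le (hbdd (p 0)) (Fin.tail p)).trans ?_)
        rw [Fin.cons_self_tail]
    have hpos : ∀ m : ℕ, 0 < ∑ s ∈ Finset.range (m + 1), w 0 s := fun m =>
      Finset.sum_pos (fun s _ => by have := hw 0 s; linarith) ⟨0, by simp⟩
    refine ⟨fun m => ∑ l ∈ Finset.range (m + 1), (w 0 l / ∑ s ∈ Finset.range (m + 1), w 0 s) *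
      ⨅ p : Fin k → ℕ, x (Fin.cons l p), fun m => ?_, ?_⟩
    · simp only [boxAverage_cons]
      exact HasIteratedLimit.sum_mul _ _ fun l _ => hasIteratedLimit_boxAverage
        (fun i => hw i.succ) (fun p p' h => hx (Fin.cons_le_cons.2 ⟨le_rfl, h⟩)) (hy l)
    · refine tendsto_weighted_sum hyanti hyc (fun m => Finset.range (m + 1))
        (fun m l => w 0 l / ∑ s ∈ Finset.range (m + 1), w 0 s)
        (fun m l => div_nonneg (by have := hw 0 l; linarith) (hpos m).le)
        (Eventually.of_forall fun m => by rw [← Finset.sum_div, div_self (hpos m).ne'])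
        (fun a m => Finset.Icc a m) (fun a m l hl => ?_)
        (fun a m l hl => (Finset.mem_Icc.1 hl).1) fun a => ?_
      · simp only [Finset.mem_Icc, Finset.mem_range] at hl ⊢
        omega
      · simpa only [Finset.sum_div] using tendsto_sum_Icc_div (hw 0) a

/-! ### Averages over simplices -/

/-- The multi-indices `q` with `q₁ + ⋯ + q_k ≤ m`. -/
def simplex (k m : ℕ) : Finset (Fin k → ℕ) := {q ∈ Finset.Iic fun _ => m | ∑ i, q i ≤ m}

lemma mem_simplex {k m : ℕ} {q : Fin k → ℕ} : q ∈ simplex k m ↔ ∑ i, q i ≤ m := by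
  simp only [simplex, Finset.mem_filter, Finset.mem_Iic, and_iff_right_iff_imp]
  exact fun h i => (Finset.single_le_sum (fun _ _ => Nat.zero_le _) (Finset.mem_univ i)).trans h

lemma card_simplex : ∀ k m : ℕ, (simplex k m).card = (m + k).choose k
  | 0, m => by
    have : simplex 0 m = Finset.univ := Finset.eq_univ_iff_forall.2 fun q => by simp [mem_simplex]
    simp [this]
  | k + 1, m => by
    have h : (simplex (k + 1) m).card
        = ∑ l ∈ Finset.range (m + 1), (simplex k (m - l)).card := by
      rw [← Finset.card_sigma]
      refine Finset.card_nbij' (fun q => ⟨q 0, Fin.tail q⟩) (fun y => Fin.cons y.1 y.2) ?_ ?_ ?_ ?_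
      · intro q hq
        simp only [Finset.mem_coe, mem_simplex, Fin.sum_univ_succ] at hq
        simp only [Finset.coe_sigma, Set.mem_sigma_iff, Finset.mem_coe, Finset.mem_range,
          mem_simplex, Fin.tail]
        omega
      · rintro ⟨l, q⟩ hq
        simp only [Finset.coe_sigma, Set.mem_sigma_iff, Finset.mem_coe, Finset.mem_range,
          mem_simplex] at hq
        simp only [Finset.mem_coe, mem_simplex, Fin.sum_univ_succ, Fin.cons_zero, Fin.cons_succ]
        omega
      · intro q _; simp
      · rintro ⟨l, q⟩ _; simp
    rw [h]
    simp only [card_simplex k]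
    -- Slicing by the first coordinate reduces the count to the hockey-stick identity, after
    -- reversing the summation.
    have := Nat.sum_range_add_choose m k
    rw [← Finset.sum_range_reflect] at this
    simpa [add_assoc] using this

/-- For shift one the ratio is `1 + k / (m + 1)`; a shift by `s` is a product of `s` such ratios. -/
lemma tendsto_choose_ratio (k s : ℕ) :
    Tendsto (fun m : ℕ => ((m + s + k).choose k : ℝ) / (m + k).choose k) atTop (𝓝 1) := by
  have hne : ∀ m : ℕ, ((m + k).choose k : ℝ) ≠ 0 := fun m =>
    Nat.cast_ne_zero.2 (Nat.choose_pos (Nat.le_add_left k m)).ne'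
  have h1 : Tendsto (fun m : ℕ => ((m + 1 + k).choose k : ℝ) / (m + k).choose k) atTop (𝓝 1) := by
    have h := (tendsto_one_div_add_atTop_nhds_zero_nat (𝕜 := ℝ)).const_mul (k : ℝ)
    have h' := h.const_add 1
    rw [mul_zero, add_zero] at h'
    refine h'.congr fun m => ?_
    have e : (m + k + 1).choose k * (m + 1) = (m + k).choose k * (m + k + 1) := by
      have := Nat.choose_mul_succ_eq (m + k) k
      rw [show m + k + 1 - k = m + 1 by omega] at this
      exact this.symm
    have e' : ((m + 1 + k).choose k : ℝ) * (m + 1) = (m + k).choose k * (m + k + 1) := by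
      rw [show m + 1 + k = m + k + 1 by ring]; exact_mod_cast e
    have := hne m
    have hm : (m : ℝ) + 1 ≠ 0 := by positivity
    field_simp
    linarith
  induction s with
  | zero => simp [div_self (hne _)]
  | succ s ih =>
    have h := (h1.comp (tendsto_add_atTop_nat s)).mul ih
    rw [one_mul] at h
    refine h.congr fun m => ?_
    have := hne (m + s)
    have := hne m
    simp only [Function.comp_apply, ← add_assoc]
    rw [div_mul_div_comm, mul_comm ((m + s + k).choose k : ℝ), mul_div_mul_right _ _ (hne _)]

lemma tendsto_simplex_average {k : ℕ} {x : (Fin k → ℕ) → ℝ} {c : ℝ} (hx : Antitone x)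
    (hc : IsGLB (Set.range x) c) :
    Tendsto (fun m : ℕ => (1 / ((m + k).choose k : ℝ)) * ∑ q ∈ simplex k m, x q) atTop (𝓝 c) := by
  classical
  have hne : ∀ m : ℕ, ((m + k).choose k : ℝ) ≠ 0 := fun m =>
    Nat.cast_ne_zero.2 (Nat.choose_pos (Nat.le_add_left k m)).ne'
  have h := tendsto_weighted_sum (l := atTop) hx hc (simplex k)
    (fun m _ => 1 / ((m + k).choose k : ℝ)) (fun m _ => by positivity)
    (Eventually.of_forall fun m => by
      rw [Finset.sum_const, card_simplex, nsmul_eq_mul, mul_one_div_cancel (hne m)])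
    (fun p₀ m => {q ∈ simplex k m | p₀ ≤ q}) (fun p₀ m => Finset.filter_subset _ _)
    (fun p₀ m p hp => (Finset.mem_filter.1 hp).2)
    (fun p₀ => by
      -- Translation by `p₀` identifies the simplex of size `m` with the points above `p₀` in the
      -- simplex of size `m + ∑ p₀`.
      have hcard : ∀ m, ({q ∈ simplex k (m + ∑ i, p₀ i) | p₀ ≤ q} : Finset _).card
          = (m + k).choose k := by
        intro m
        rw [← card_simplex k m]
        refine Finset.card_nbij' (fun q => q - p₀) (fun q => q + p₀) ?_ ?_ ?_ ?_
        · intro q hq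
          simp only [Finset.coe_filter, mem_simplex, Set.mem_ofPred_eq] at hq
          have h2 : ∑ i, (q i - p₀ i) + ∑ i, p₀ i = ∑ i, q i := by
            rw [← Finset.sum_add_distrib]
            exact Finset.sum_congr rfl fun i _ => Nat.sub_add_cancel (hq.2 i)
          simp only [Finset.mem_coe, mem_simplex, Pi.sub_apply]
          omega
        · intro q hq
          simp only [Finset.mem_coe, mem_simplex] at hq
          simp only [Finset.coe_filter, mem_simplex, Set.mem_ofPred_eq, Pi.add_apply,
            Finset.sum_add_distrib]
          exact ⟨by omega, fun i => by simp⟩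
        · intro q hq
          simp only [Finset.coe_filter, Set.mem_ofPred_eq] at hq
          exact tsub_add_cancel_of_le hq.2
        · intro q _; exact add_tsub_cancel_right q p₀
      rw [← tendsto_add_atTop_iff_nat (∑ i, p₀ i)]
      have h := (tendsto_choose_ratio k (∑ i, p₀ i)).inv₀ one_ne_zero
      rw [inv_one] at h
      refine h.congr fun m => ?_
      rw [Finset.sum_const, hcard, nsmul_eq_mul, inv_div, mul_one_div])
  refine h.congr fun m => ?_
  rw [Finset.mul_sum]

/-! ### Rank and trace of orthogonal projections -/

section Trace

variable {H : Type*} [NormedAddCommGroup H] [InnerProductSpace ℂ H] [CompleteSpace H]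

/-- Expanding `A` in rank one projections turns the sum into finitely many Parseval identities. With
the basis arbitrary, this evaluates `opTrace` and also lets ranks be computed in the basis `e n`. -/
lemma hasSum_inner_of_isStarProjection {ι : Type*} (b : HilbertBasis ι ℂ H) {A : H →L[ℂ] H}
    (hA : IsStarProjection A) [FiniteDimensional ℂ (LinearMap.range A.toLinearMap)] :
    HasSum (fun i => inner ℂ (b i) (A (b i))) (opRank A : ℂ) := by
  obtain ⟨_, hU⟩ := isStarProjection_iff_eq_starProjection_range.1 hA
  have key : ∀ v, inner ℂ v (A v)
      = ∑ w, inner ℂ ((stdOrthonormalBasis ℂ (LinearMap.range A.toLinearMap) w : _) : H) v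
        * inner ℂ v ((stdOrthonormalBasis ℂ (LinearMap.range A.toLinearMap) w : _) : H) := by
    intro v
    conv_lhs => rw [hU]
    rw [(stdOrthonormalBasis ℂ (LinearMap.range A.toLinearMap)).starProjection_eq_sum_rankOne]
    simp
  have h := hasSum_sum (s := Finset.univ) fun w _ => b.hasSum_inner_mul_inner
    ((stdOrthonormalBasis ℂ (LinearMap.range A.toLinearMap) w : _) : H)
    ((stdOrthonormalBasis ℂ (LinearMap.range A.toLinearMap) w : _) : H)
  rw [funext fun i => key (b i)]
  have hone : ∀ w, inner ℂ ((stdOrthonormalBasis ℂ (LinearMap.range A.toLinearMap) w : _) : H)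
      ((stdOrthonormalBasis ℂ (LinearMap.range A.toLinearMap) w : _) : H) = 1 := fun w => by
    rw [← Submodule.coe_inner, inner_self_eq_norm_sq_to_K, OrthonormalBasis.norm_eq_one]; simp
  rw [Finset.sum_congr rfl fun w _ => hone w] at h
  simpa [opRank] using h

lemma opTrace_of_isStarProjection {A : H →L[ℂ] H} (hA : IsStarProjection A)
    [FiniteDimensional ℂ (LinearMap.range A.toLinearMap)] : opTrace A = opRank A := by
  obtain ⟨b, hb⟩ := (exists_hilbertBasis ℂ H).choose_spec
  have h := hasSum_inner_of_isStarProjection b hA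
  rw [hb] at h
  exact h.tsum_eq

end Trace

section Fock

variable {k : ℕ} {n : Fin k → ℕ}

/-! ### Coordinate projections -/

section WordProj

lemma memℓp_indicator {G : Type*} [NormedAddCommGroup G]
    (A : Set (Words n)) (f : FockTensor n G) :
    Memℓp (A.indicator f : Words n → G) 2 := by
  refine memℓp_gen (Summable.of_nonneg_of_le (fun α => by positivity) (fun α => ?_)
    ((memℓp_gen_iff (by norm_num)).1 f.2))
  exact Real.rpow_le_rpow (norm_nonneg _) (norm_indicator_le_norm_self _ _) (by norm_num)

variable {G : Type*} [NormedAddCommGroup G] [InnerProductSpace ℂ G] [CompleteSpace G]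

/-- The truncation of `f` to `A` lies in the closed span, being the limit of its finite partial
sums, and the remainder is orthogonal to every generator. Projections thus become indicator
functions. -/
lemma wordProj_apply (A : Set (Words n)) (f : FockTensor n G) (β : Words n) :
    wordProj G A f β = A.indicator (f : Words n → G) β := by
  classical
  let v : FockTensor n G := ⟨A.indicator f, memℓp_indicator A f⟩
  have hv : ∀ α, v α = A.indicator (f : Words n → G) α := fun _ => rfl
  suffices h : wordProj G A f = v by rw [h]
  refine Submodule.eq_starProjection_of_mem_orthogonal ?_ ?_
  · refine (Submodule.isClosed_topologicalClosure _).mem_of_tendsto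
      (lp.hasSum_single (p := 2) (by norm_num) v) (Eventually.of_forall fun s => ?_)
    refine Submodule.sum_mem _ fun α _ => Submodule.le_topologicalClosure _ ?_
    by_cases hα : α ∈ A
    · exact Submodule.subset_span ⟨α, hα, fun β hβ => lp.single_apply_ne _ _ _ hβ⟩
    · rw [hv, Set.indicator_of_notMem hα]; simp
  · rw [Submodule.orthogonal_closure, Submodule.mem_orthogonal]
    intro u hu
    induction hu using Submodule.span_induction with
    | mem u hu =>
      obtain ⟨α, hα, hu⟩ := hu
      rw [lp.inner_eq_tsum]
      refine (tsum_congr fun β => ?_).trans tsum_zero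
      by_cases hβ : β = α
      · subst hβ; simp [hv, hα]
      · simp [hu β hβ]
    | zero => simp
    | add u w _ _ hu hw => rw [inner_add_left, hu, hw, add_zero]
    | smul a u _ hu => rw [inner_smul_left, hu, mul_zero]

lemma isStarProjection_wordProj (A : Set (Words n)) : IsStarProjection (wordProj G A) :=
  isStarProjection_starProjection

end WordProj

/-! ### Coordinates in the Fock space -/

lemma inner_e (α : Words n) (f : Fock n) : inner ℂ (e n α) f = f α :=
  ((e n).repr_apply_apply f α).symm

lemma e_apply_self (α : Words n) : e n α α = 1 := by
  rw [← inner_e, inner_self_eq_norm_sq_to_K, (e n).orthonormal.1]; simp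

lemma e_apply_ne {α β : Words n} (h : β ≠ α) : e n α β = 0 := by
  rw [← inner_e, (e n).orthonormal.2 h]

lemma star_S_apply (i : Fin k) (j : Fin (n i)) (f : Fock n) (α : Words n) :
    star (S n i j) f α = f (consWord i j α) := by
  rw [← inner_e, ContinuousLinearMap.star_eq_adjoint, ContinuousLinearMap.adjoint_inner_right,
    S_apply_e, inner_e]

lemma S_apply_consWord (i : Fin k) (j : Fin (n i)) (f : Fock n) (α : Words n) :
    S n i j f (consWord i j α) = f α := by
  rw [← inner_e, ← S_apply_e, ← inner_e α f]
  exact LinearIsometry.inner_map_map _ _ _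

lemma S_apply_of_notMem {i : Fin k} {j : Fin (n i)} (f : Fock n) {β : Words n}
    (hβ : ∀ α, consWord i j α ≠ β) : S n i j f β = 0 := by
  have h : star (S n i j) (e n β) = 0 := by
    ext α
    rw [star_S_apply, e_apply_ne (hβ α)]; rfl
  rw [← inner_e, ← ContinuousLinearMap.adjoint_inner_left, ← ContinuousLinearMap.star_eq_adjoint, h,
    inner_zero_left]

lemma fock_ext_of_e {E : Type*} [NormedAddCommGroup E] [NormedSpace ℂ E] {A B : Fock n →L[ℂ] E}
    (h : ∀ α, A (e n α) = B (e n α)) : A = B := by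
  have hd := (e n).dense_span
  refine ContinuousLinearMap.ext_on (s := Set.range (e n)) ?_ ?_
  · rw [dense_iff_closure_eq, ← Submodule.topologicalClosure_coe, hd]; rfl
  · rintro _ ⟨α, rfl⟩; exact h α

/-- Rewriting concatenation as multiplication in the product monoid reduces commutation of different
tensor factors to `Pi.mulSingle_commute`. -/
lemma consWord_eq (i : Fin k) (j : Fin (n i)) (α : Words n) :
    consWord i j α = Pi.mulSingle i (FreeMonoid.of j) * α := by
  funext l
  by_cases h : l = i
  · subst h; simp [consWord]
  · simp [consWord, h]

lemma commute_S {s t : Fin k} (h : s ≠ t) (a : Fin (n s)) (b : Fin (n t)) :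
    Commute (S n s a) (S n t b) := by
  refine fock_ext_of_e fun α => ?_
  simp only [mul_apply_eq_comp, S_apply_e, consWord_eq, ← mul_assoc]
  rw [(Pi.mulSingle_commute h _ _).eq]

lemma prod_map_mulSingle (β : Words n) (j : Fin k) : ∀ l : List (Fin k), l.Nodup →
    ((l.map fun i => (Pi.mulSingle i (β i) : Words n)).prod) j = if j ∈ l then β j else 1
  | [], _ => by simp
  | i :: l, h => by
    rw [List.map_cons, List.prod_cons, Pi.mul_apply, prod_map_mulSingle β j l h.of_cons]
    have hi := (List.nodup_cons.1 h).1
    by_cases hj : j = i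
    · subst hj; simp [hi]
    · simp [hj]

lemma prod_map_mulSingle_finRange (β : Words n) :
    ((List.finRange k).map fun i => (Pi.mulSingle i (β i) : Words n)).prod = β := by
  funext j
  rw [prod_map_mulSingle β j _ (List.nodup_finRange k), if_pos (List.mem_finRange j)]

/-- Adjoints strip prefixes in the opposite order, hence the reversed list; the order is immaterial
because the factors occupy distinct coordinates. -/
lemma prod_map_mulSingle_finRange_reverse (β : Words n) :
    ((List.finRange k).reverse.map fun i => (Pi.mulSingle i (β i) : Words n)).prod = β := by
  funext j
  rw [prod_map_mulSingle β j _ (List.nodup_reverse.2 (List.nodup_finRange k)),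
    if_pos (List.mem_reverse.2 (List.mem_finRange j))]

lemma wordOp_mul {H : Type*} [NormedAddCommGroup H] [InnerProductSpace ℂ H]
    (X : Tuple n H) (i : Fin k) (j : Fin (n i)) (w : FreeMonoid (Fin (n i))) :
    wordOp X i (FreeMonoid.of j * w) = X i j * wordOp X i w := by
  simp [wordOp]

lemma wordOp_S_apply_e (i : Fin k) (w : FreeMonoid (Fin (n i))) (α : Words n) :
    wordOp (S n) i w (e n α) = e n (Pi.mulSingle i w * α) := by
  induction w using FreeMonoid.inductionOn' with
  | one => simp [wordOp]
  | of_mul j w ih =>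
    rw [wordOp_mul, mul_apply_eq_comp, ih, S_apply_e, consWord_eq, ← mul_assoc,
      Pi.mulSingle_mul]

lemma prod_map_wordOp_S_apply_e (α β : Words n) : ∀ l : List (Fin k),
    (l.map fun i => wordOp (S n) i (β i)).prod (e n α)
      = e n ((l.map fun i => (Pi.mulSingle i (β i) : Words n)).prod * α)
  | [] => by simp
  | i :: l => by
    simp only [List.map_cons, List.prod_cons, mul_apply_eq_comp]
    rw [prod_map_wordOp_S_apply_e α β l, wordOp_S_apply_e, mul_assoc]

/-! ### Coordinate subspaces of finite dimension -/

lemma finiteDimensional_range_wordProj {A : Set (Words n)} (hA : A.Finite) :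
    FiniteDimensional ℂ (LinearMap.range (wordProj ℂ A).toLinearMap) := by
  have : Finite A := hA
  refine FiniteDimensional.of_injective (V₂ := A → ℂ)
    { toFun := fun f α => (f : Fock n) α
      map_add' := fun _ _ => rfl
      map_smul' := fun _ _ => rfl } ?_
  rintro ⟨_, f, rfl⟩ ⟨_, g, rfl⟩ h
  ext α
  change wordProj ℂ A f α = wordProj ℂ A g α
  by_cases hα : α ∈ A
  · exact congrFun h ⟨α, hα⟩
  · simp only [wordProj_apply, Set.indicator_of_notMem hα]

/-- Both numbers are the trace computed in the basis `e n`. -/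
lemma opRank_wordProj {A : Set (Words n)} (hA : A.Finite) :
    opRank (wordProj ℂ A) = A.ncard := by
  classical
  have := finiteDimensional_range_wordProj hA
  have h := hasSum_inner_of_isStarProjection (e n) (isStarProjection_wordProj (G := ℂ) A)
  have h' : HasSum (fun α => inner ℂ (e n α) (wordProj ℂ A (e n α))) (A.ncard : ℂ) := by
    have : (A.ncard : ℂ) = ∑ α ∈ hA.toFinset, inner ℂ (e n α) (wordProj ℂ A (e n α)) := by
      rw [Finset.sum_congr rfl (g := fun _ => (1 : ℂ)), Finset.sum_const, nsmul_eq_mul, mul_one,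
        Set.ncard_eq_toFinset_card A hA]
      intro α hα
      rw [inner_e, wordProj_apply, Set.indicator_of_mem (hA.mem_toFinset.1 hα), e_apply_self]
    rw [this]
    refine hasSum_sum_of_ne_finset_zero fun α hα => ?_
    rw [inner_e, wordProj_apply, Set.indicator_of_notMem fun h => hα (hA.mem_toFinset.2 h)]
  exact_mod_cast h.unique h'

/-- The words of multi-degree `q`, coordinate by coordinate. -/
def wordsOfDegEquiv (q : Fin k → ℕ) :
    {α : Words n | deg α = q} ≃ ∀ i, List.Vector (Fin (n i)) (q i) where
  toFun α i := ⟨(α.1 i).toList, congrFun α.2 i⟩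
  invFun v := ⟨fun i => FreeMonoid.ofList (v i).1, funext fun i => (v i).2⟩
  left_inv _ := rfl
  right_inv _ := rfl

lemma finite_deg_eq (q : Fin k → ℕ) : {α : Words n | deg α = q}.Finite :=
  Finite.of_equiv _ (wordsOfDegEquiv (n := n) q).symm

lemma ncard_deg_eq (q : Fin k → ℕ) : {α : Words n | deg α = q}.ncard = ∏ i, n i ^ q i := by
  rw [← Nat.card_coe_set_eq, Nat.card_congr (wordsOfDegEquiv q), Nat.card_eq_fintype_card]
  simp [Fintype.card_pi]

lemma finite_deg_le (q : Fin k → ℕ) : {α : Words n | deg α ≤ q}.Finite := by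
  refine ((Finset.Iic q).finite_toSet.biUnion fun p _ => finite_deg_eq (n := n) p).subset ?_
  intro α hα
  exact Set.mem_biUnion (Finset.mem_coe.2 (Finset.mem_Iic.2 hα)) rfl

lemma projLE_eq_sum (q : Fin k → ℕ) : projLE n ℂ q = ∑ p ∈ Finset.Iic q, projEq n ℂ p := by
  classical
  ext f α
  rw [sum_apply, lp.coeFn_sum, Finset.sum_apply]
  simp only [projLE, projEq, wordProj_apply, Set.indicator_apply, Set.mem_ofPred_eq]
  rw [Finset.sum_ite_eq]
  simp

lemma opRank_projEq (q : Fin k → ℕ) : opRank (projEq n ℂ q) = ∏ i, n i ^ q i := by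
  rw [projEq, opRank_wordProj (finite_deg_eq q), ncard_deg_eq]

end Fock

section Graded

open MeasureTheory

variable {k : ℕ} {n : Fin k → ℕ}

/-! ### Graded subspaces -/

lemma hasSum_inner_gauge (z : Fin k → Circle) (f g : Fock n) :
    HasSum (fun α => inner ℂ (g α) (f α) * ((∏ i, z i ^ (α i).length : Circle) : ℂ))
      (inner ℂ g (gauge n z f)) := by
  have h := ((e n).hasSum_repr f).mapL (innerSL ℂ g ∘L gauge n z)
  refine h.congr_fun ?_
  intro α
  have : (e n).repr f α = f α := rfl
  have h' : inner ℂ g (e n α) = starRingEnd ℂ (g α) := by rw [← inner_conj_symm, inner_e]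
  simp only [ContinuousLinearMap.comp_apply, map_smul, gauge_apply_e, innerSL_apply_apply,
    smul_eq_mul, this, h', RCLike.inner_apply]
  ring

/-- Coefficients of an absolutely convergent Fourier series on the torus that vanishes
identically, summed over a fibre of the frequency map, add up to zero. -/
lemma hasSum_fiber_eq_zero {ι : Type*} (d : ι → Fin k → ℕ) (a : ι → ℂ) (ha : Summable a)
    (h : ∀ z : Fin k → Circle, HasSum (fun α => a α * ((∏ i, z i ^ d α i : Circle) : ℂ)) 0)
    (q : Fin k → ℕ) : HasSum ({α | d α = q}.indicator a) 0 := by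
  classical
  let _ : MeasureSpace UnitAddCircle := ⟨AddCircle.haarAddCircle⟩
  have : IsProbabilityMeasure (volume : Measure UnitAddCircle) :=
    inferInstanceAs (IsProbabilityMeasure AddCircle.haarAddCircle)
  let m : (Fin k → ℕ) → Fin k → ℤ := fun p i => p i
  have hm : ∀ p x, UnitAddTorus.mFourier (m p) x
      = ((∏ i, (AddCircle.toCircle (x i)) ^ p i : Circle) : ℂ) := by
    intro p x
    refine Eq.trans ?_ (map_prod Circle.coeHom _ _).symm
    simp [UnitAddTorus.mFourier, m, fourier_apply, AddCircle.toCircle_nsmul]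
    rfl
  -- Absolute summability gives convergence in the sup norm, so the sum is a continuous function
  -- determined by its point values, here zero.
  have hs : Summable fun α => a α • UnitAddTorus.mFourier (m (d α)) := by
    refine Summable.of_norm ?_
    simpa [norm_smul, UnitAddTorus.mFourier_norm] using ha.norm
  have h0 : HasSum (fun α => a α • UnitAddTorus.mFourier (m (d α))) 0 := by
    have : ∑' α, a α • UnitAddTorus.mFourier (m (d α)) = 0 := by
      ext x
      have h1 := (ContinuousMap.evalCLM ℂ x).hasSum hs.hasSum
      have h2 := h fun i => AddCircle.toCircle (x i)
      simp only [← hm] at h2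
      exact h1.unique h2
    rw [← this]; exact hs.hasSum
  -- Pairing in `L²` with the character of frequency `q` extracts the Fourier coefficient: by
  -- orthonormality only the fibre `d α = q` survives.
  have h3 := h0.mapL (innerSL ℂ (UnitAddTorus.mFourierLp 2 (m q)) ∘L
    (ContinuousMap.toLp (E := ℂ) 2 volume ℂ))
  rw [map_zero] at h3
  refine h3.congr_fun fun α => ?_
  have h4 : ContinuousMap.toLp (E := ℂ) 2 volume ℂ (UnitAddTorus.mFourier (m (d α)))
    = UnitAddTorus.mFourierLp 2 (m (d α)) := rfl
  have h5 := orthonormal_iff_ite.1 (UnitAddTorus.orthonormal_mFourier (d := Fin k)) (m q) (m (d α))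
  have h6 : m q = m (d α) ↔ d α = q := by
    constructor
    · intro h; funext i; have := congrFun h i; simpa [m] using this.symm
    · intro h; rw [h]
  simp only [ContinuousLinearMap.comp_apply, map_smul, h4, innerSL_apply_apply, smul_eq_mul]
  rw [h5]
  by_cases hα : d α = q
  · simp [hα]
  · simp [hα, h6]

lemma summable_inner_coord (f g : Fock n) : Summable fun α => inner ℂ (g α) (f α) :=
  lp.summable_inner g f

/-- For `g ∈ Mᗮ` the function `z ↦ ⟨g, U(z) f⟩` vanishes on the torus, and its Fourier coefficient
at `q` is `⟨g, P_q f⟩`. Closedness of `M` gives `M = Mᗮᗮ`. -/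
lemma projEq_mem_of_isGraded {M : Submodule ℂ (Fock n)} (hM : IsClosed (M : Set (Fock n)))
    (hgr : IsGraded M) (q : Fin k → ℕ) {f : Fock n} (hf : f ∈ M) : projEq n ℂ q f ∈ M := by
  have : CompleteSpace M := hM.completeSpace_coe
  rw [← Submodule.orthogonal_orthogonal M, Submodule.mem_orthogonal]
  intro g hg
  have h := hasSum_fiber_eq_zero (fun α : Words n => deg α) (fun α => inner ℂ (g α) (f α))
    (summable_inner_coord f g) (fun z => by
      have h := hasSum_inner_gauge z f g
      rwa [Submodule.inner_left_of_mem_orthogonal (hgr z f hf) hg] at h) q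
  have h' := lp.hasSum_inner (𝕜 := ℂ) g (projEq n ℂ q f)
  refine h'.unique (h.congr_fun fun α => ?_)
  rw [projEq, wordProj_apply]
  by_cases hα : deg α = q <;> simp [hα]

lemma commute_projEq {M : Submodule ℂ (Fock n)} (hM : IsClosed (M : Set (Fock n)))
    (hgr : IsGraded M) (q : Fin k → ℕ) : Commute Mᗮ.starProjection (projEq n ℂ q) := by
  have : CompleteSpace M := hM.completeSpace_coe
  rw [Submodule.starProjection_orthogonal']
  refine (Commute.one_left _).sub_left ?_
  have hP : IsStarProjection (projEq n ℂ q) := isStarProjection_wordProj _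
  have hM' : IsStarProjection M.starProjection := isStarProjection_starProjection
  have h1 : M.starProjection * (projEq n ℂ q * M.starProjection)
      = projEq n ℂ q * M.starProjection := by
    ext1 f
    exact Submodule.starProjection_eq_self_iff.2
      (projEq_mem_of_isGraded hM hgr q (Submodule.starProjection_apply_mem _ _))
  -- Invariance of `M` under a self-adjoint operator yields commutation, on comparing with the
  -- adjoint identity.
  have h2 := congrArg star h1
  simp only [star_mul, hP.isSelfAdjoint.star_eq, hM'.isSelfAdjoint.star_eq] at h2
  rw [mul_assoc] at h2
  exact h2.symm.trans h1

end Graded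

section Compression

variable {k : ℕ} {n : Fin k → ℕ} {M : Submodule ℂ (Fock n)}

/-! ### Compressions to the orthocomplement of an invariant subspace -/

/-- The compression `P_{M⊥} Y|_{M⊥}` of an operator. -/
def compress (M : Submodule ℂ (Fock n)) (Y : Fock n →L[ℂ] Fock n) : Mᗮ →L[ℂ] Mᗮ :=
  Mᗮ.orthogonalProjectionOnto ∘L Y ∘L Mᗮ.subtypeL

lemma compress_apply (Y : Fock n →L[ℂ] Fock n) (f : Mᗮ) :
    compress M Y f = Mᗮ.orthogonalProjectionOnto (Y f) := rfl

lemma compression_eq_compress (i : Fin k) (j : Fin (n i)) :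
    compression M i j = compress M (S n i j) := rfl

lemma star_compress (Y : Fock n →L[ℂ] Fock n) : star (compress M Y) = compress M (star Y) := by
  simp only [compress, ContinuousLinearMap.star_eq_adjoint, ContinuousLinearMap.adjoint_comp,
    Submodule.adjoint_subtypeL, Submodule.adjoint_orthogonalProjectionOnto,
    ContinuousLinearMap.comp_assoc]

lemma star_S_mem (hM : IsInvariantSubspace M) (i : Fin k) (j : Fin (n i)) {f : Fock n}
    (hf : f ∈ Mᗮ) : star (S n i j) f ∈ Mᗮ := by
  rw [Submodule.mem_orthogonal]
  intro g hg
  rw [ContinuousLinearMap.star_eq_adjoint, ContinuousLinearMap.adjoint_inner_right]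
  exact Submodule.inner_right_of_mem_orthogonal (hM.invariant i j g hg) hf

lemma star_compression_apply (hM : IsInvariantSubspace M) (i : Fin k) (j : Fin (n i)) (f : Mᗮ) :
    ((star (compression M i j) f : Mᗮ) : Fock n) = star (S n i j) f := by
  rw [compression_eq_compress, star_compress, compress_apply]
  exact Submodule.starProjection_eq_self_iff.2 (star_S_mem hM i j f.2)

/-- Since `S n i j` maps `M` into `M`, the component of `v` in `M` does not contribute. The
projection therefore intertwines `S` with its compression, and words in the compression are
compressions of words in `S`. -/
lemma compression_projection (hM : IsInvariantSubspace M) (i : Fin k) (j : Fin (n i))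
    (v : Fock n) :
    compression M i j (Mᗮ.orthogonalProjectionOnto v)
      = Mᗮ.orthogonalProjectionOnto (S n i j v) := by
  refine ext_inner_left ℂ fun f => ?_
  rw [← ContinuousLinearMap.adjoint_inner_left, ← ContinuousLinearMap.star_eq_adjoint,
    Submodule.coe_inner, Submodule.coe_inner, star_compression_apply hM,
    Submodule.coe_orthogonalProjectionOnto_apply, Submodule.coe_orthogonalProjectionOnto_apply,
    ← Submodule.inner_starProjection_left_eq_right, ← Submodule.inner_starProjection_left_eq_right,
    Submodule.starProjection_eq_self_iff.2 (star_S_mem hM i j f.2),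
    Submodule.starProjection_eq_self_iff.2 f.2, ContinuousLinearMap.star_eq_adjoint,
    ContinuousLinearMap.adjoint_inner_left]

lemma commute_compression (hM : IsInvariantSubspace M) {s t : Fin k} (h : s ≠ t)
    (a : Fin (n s)) (b : Fin (n t)) : Commute (compression M s a) (compression M t b) := by
  ext1 f
  have h' := congrArg (fun A : Fock n →L[ℂ] Fock n => A f) (commute_S h a b).eq
  simp only [mul_apply_eq_comp] at h' ⊢
  rw [compression_eq_compress t, compress_apply, compression_projection hM, h',
    ← compression_projection hM]
  rfl

lemma wordOp_compression_projection (hM : IsInvariantSubspace M) (i : Fin k)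
    (w : FreeMonoid (Fin (n i))) (v : Fock n) :
    wordOp (compression M) i w (Mᗮ.orthogonalProjectionOnto v)
      = Mᗮ.orthogonalProjectionOnto (wordOp (S n) i w v) := by
  induction w using FreeMonoid.inductionOn' with
  | one => simp [wordOp]
  | of_mul j w ih =>
    rw [wordOp_mul, wordOp_mul, mul_apply_eq_comp, mul_apply_eq_comp, ih,
      compression_projection hM]

lemma prod_map_wordOp_compression (hM : IsInvariantSubspace M) (α : Words n) (v : Fock n) :
    ∀ l : List (Fin k),
      (l.map fun i => wordOp (compression M) i (α i)).prod (Mᗮ.orthogonalProjectionOnto v)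
        = Mᗮ.orthogonalProjectionOnto ((l.map fun i => wordOp (S n) i (α i)).prod v)
  | [] => by simp
  | i :: l => by
    simp only [List.map_cons, List.prod_cons, mul_apply_eq_comp]
    rw [prod_map_wordOp_compression hM α v l, wordOp_compression_projection hM]

lemma prod_wordOp_compression_e (hM : IsInvariantSubspace M) (α : Words n) :
    (List.ofFn fun i => wordOp (compression M) i (α i)).prod
        (Mᗮ.orthogonalProjectionOnto (e n 1)) = Mᗮ.orthogonalProjectionOnto (e n α) := by
  rw [List.ofFn_eq_map, prod_map_wordOp_compression hM, prod_map_wordOp_S_apply_e,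
    prod_map_mulSingle_finRange, mul_one]

lemma star_wordOp_compression_apply (hM : IsInvariantSubspace M) (i : Fin k)
    (w : FreeMonoid (Fin (n i))) (f : Mᗮ) (α : Words n) :
    ((star (wordOp (compression M) i w) f : Mᗮ) : Fock n) α
      = (f : Fock n) (Pi.mulSingle i w * α) := by
  induction w using FreeMonoid.inductionOn' generalizing f with
  | one => simp [wordOp]
  | of_mul j w ih =>
    rw [wordOp_mul, star_mul, mul_apply_eq_comp, ih, star_compression_apply hM, star_S_apply,
      consWord_eq, ← mul_assoc, ← Pi.mulSingle_mul]

lemma prod_map_star_wordOp_compression_apply (hM : IsInvariantSubspace M) (β : Words n) :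
    ∀ (l : List (Fin k)) (f : Mᗮ) (α : Words n),
      (((l.map fun i => star (wordOp (compression M) i (β i))).prod f : Mᗮ) : Fock n) α
        = (f : Fock n) ((l.reverse.map fun i => (Pi.mulSingle i (β i) : Words n)).prod * α)
  | [], f, α => by simp
  | i :: l, f, α => by
    simp only [List.map_cons, List.prod_cons, mul_apply_eq_comp, List.reverse_cons,
      List.map_append, List.prod_append, List.map_nil, List.prod_nil, mul_one]
    rw [star_wordOp_compression_apply hM, prod_map_star_wordOp_compression_apply hM β l, mul_assoc]

lemma prod_star_wordOp_compression_apply_one (hM : IsInvariantSubspace M) (β : Words n) (f : Mᗮ) :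
    (((List.ofFn fun i => star (wordOp (compression M) i (β i))).prod f : Mᗮ) : Fock n) 1
      = (f : Fock n) β := by
  rw [List.ofFn_eq_map, prod_map_star_wordOp_compression_apply hM,
    prod_map_mulSingle_finRange_reverse, mul_one]

/-! ### The defect of the compression -/

/-- Adjoints of the compression are restrictions to `Mᗮ`, and the projection intertwines, so all
defects can be computed on the Fock space before compressing. -/
lemma Phi_compress (hM : IsInvariantSubspace M) (i : Fin k) (Y : Fock n →L[ℂ] Fock n) :
    Phi (compression M) i (compress M Y) = compress M (Phi (S n) i Y) := by
  ext1 f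
  simp only [Phi, LinearMap.coe_mk, AddHom.coe_mk, sum_apply, mul_apply_eq_comp,
    compress_apply, map_sum, star_compression_apply hM, compression_projection hM]

lemma one_sub_Phi_compress (hM : IsInvariantSubspace M) (i : Fin k) (Y : Fock n →L[ℂ] Fock n) :
    (1 - Phi (compression M) i) (compress M Y) = compress M ((1 - Phi (S n) i) Y) := by
  rw [LinearMap.sub_apply, LinearMap.sub_apply, Phi_compress hM]
  ext1 f
  simp [compress_apply]

lemma eq_one_or_exists_of_mul {ι : Type*} (w : FreeMonoid ι) :
    w = 1 ∨ ∃ j w', w = FreeMonoid.of j * w' := by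
  induction w using FreeMonoid.inductionOn' with
  | one => exact Or.inl rfl
  | of_mul j w _ => exact Or.inr ⟨j, w, rfl⟩

/-- By `hA`, conjugating the projection by `S n i j` gives the projection onto the words of `A`
whose `i`-th component begins with `g_j`. Removing these for all `j` leaves an empty `i`-th
component. -/
lemma one_sub_Phi_S_wordProj (i : Fin k) {A : Set (Words n)}
    (hA : ∀ j α, consWord i j α ∈ A ↔ α ∈ A) :
    (1 - Phi (S n) i) (wordProj ℂ A) = wordProj ℂ {α | α ∈ A ∧ α i = 1} := by
  classical
  ext f β
  simp only [LinearMap.sub_apply, Module.End.one_apply, Phi, LinearMap.coe_mk, AddHom.coe_mk,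
    sub_apply, sum_apply, mul_apply_eq_comp, lp.coeFn_sub, Pi.sub_apply, lp.coeFn_sum,
    Finset.sum_apply]
  rcases eq_one_or_exists_of_mul (β i) with hβ | ⟨j, w, hβ⟩
  · rw [Finset.sum_eq_zero, sub_zero, wordProj_apply, wordProj_apply]
    · simp [Set.indicator_apply, hβ]
    · intro j _
      refine S_apply_of_notMem _ fun α h => ?_
      have := congrFun h i
      rw [hβ, consWord, Function.update_self] at this
      exact absurd (congrArg FreeMonoid.length this) (by simp [FreeMonoid.length_mul])
  · have hcons : consWord i j (Function.update β i w) = β := by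
      simp [consWord, ← hβ]
    rw [Finset.sum_eq_single j]
    · nth_rewrite 2 [← hcons]
      rw [S_apply_consWord, wordProj_apply, wordProj_apply, wordProj_apply, Set.indicator_apply,
        Set.indicator_apply, star_S_apply, hcons, ← hA j (Function.update β i w), hcons, sub_self,
        Set.indicator_of_notMem]
      rintro ⟨_, h⟩
      rw [hβ] at h
      exact absurd (congrArg FreeMonoid.length h) (by simp [FreeMonoid.length_mul])
    · intro j' _ hj'
      refine S_apply_of_notMem _ fun α h => hj' ?_
      have := congrFun h i
      rw [hβ, consWord, Function.update_self] at this
      exact (List.cons.inj this).1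
    · simp

lemma prod_map_one_sub_Phi (hM : IsInvariantSubspace M) {p : Fin k → ℕ} (hp : ∀ i, p i ≤ 1) :
    ∀ l : List (Fin k), l.Nodup → (l.map fun i => (1 - Phi (compression M) i) ^ p i).prod 1
      = compress M (wordProj ℂ {α | ∀ i ∈ l, p i = 1 → α i = 1})
  | [], _ => by
    ext f
    simp only [List.map_nil, List.prod_nil, Module.End.one_apply, compress_apply]
    have : wordProj ℂ {α : Words n | ∀ i ∈ ([] : List (Fin k)), p i = 1 → α i = 1} = 1 := by
      ext f β; simp [wordProj_apply]
    rw [this]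
    simp
  | i :: l, h => by
    rw [List.map_cons, List.prod_cons, Module.End.mul_apply, prod_map_one_sub_Phi hM hp l h.of_cons]
    have hi := (List.nodup_cons.1 h).1
    rcases Nat.le_one_iff_eq_zero_or_eq_one.1 (hp i) with h0 | h1
    · simp [h0]
    · rw [h1, pow_one, one_sub_Phi_compress hM, one_sub_Phi_S_wordProj]
      · congr 2
        ext α
        simp [h1, and_comm]
      -- The constraints imposed so far concern only coordinates in `l`, which does not contain `i`,
      -- so prefixing in coordinate `i` does not affect them.
      · intro j α
        refine forall_congr' fun s => forall_congr' fun hs => ?_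
        rw [consWord, Function.update_of_ne (by rintro rfl; exact hi hs)]

lemma defectPow_compression (hM : IsInvariantSubspace M) {p : Fin k → ℕ} (hp : ∀ i, p i ≤ 1) :
    defectPow (compression M) p = compress M (wordProj ℂ {α | ∀ i, p i = 1 → α i = 1}) := by
  rw [defectPow, List.ofFn_eq_map, prod_map_one_sub_Phi hM hp _ (List.nodup_finRange k)]
  simp

lemma defect_compression (hM : IsInvariantSubspace M) :
    defect (compression M) = compress M (wordProj ℂ {1}) := by
  rw [defect, defectPow_compression hM fun _ => le_rfl]
  congr 2
  ext α
  simp [funext_iff]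

lemma isPositive_compress {Y : Fock n →L[ℂ] Fock n} (hY : Y.IsPositive) :
    (compress M Y).IsPositive := by
  have := hY.conj_adjoint Mᗮ.orthogonalProjectionOnto
  rwa [Submodule.adjoint_orthogonalProjectionOnto] at this

lemma inPolyball_compression (hM : IsInvariantSubspace M) : InPolyball (compression M) where
  commute _ _ h a b := commute_compression hM h a b
  positive p hp := by
    rw [defectPow_compression hM hp]
    exact isPositive_compress
      (ContinuousLinearMap.IsPositive.of_isStarProjection (isStarProjection_wordProj _))

lemma wordProj_one_apply (f : Fock n) : wordProj ℂ {1} f = f 1 • e n 1 := by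
  ext β
  rw [wordProj_apply, lp.coeFn_smul, Pi.smul_apply]
  by_cases h : β = 1
  · subst h; simp [e_apply_self]
  · simp [h, e_apply_ne h]

lemma defect_compression_apply (hM : IsInvariantSubspace M) (f : Mᗮ) :
    defect (compression M) f
      = (f : Fock n) 1 • Mᗮ.orthogonalProjectionOnto (e n 1) := by
  rw [defect_compression hM, compress_apply, wordProj_one_apply, map_smul]

lemma hasFiniteRankDefect_compression (hM : IsInvariantSubspace M) :
    HasFiniteRankDefect (compression M) := by
  refine Submodule.finiteDimensional_of_le
    (S₂ := Submodule.span ℂ {Mᗮ.orthogonalProjectionOnto (e n 1)}) ?_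
  rintro _ ⟨f, rfl⟩
  exact Submodule.mem_span_singleton.2 ⟨_, (defect_compression_apply hM f).symm⟩

end Compression

section Dimensions

variable {k : ℕ} {n : Fin k → ℕ} {M : Submodule ℂ (Fock n)}

/-! ### Dimensions of the homogeneous components -/

/-- The dimension of the homogeneous component of degree `q` of `M⊥`. -/
def homDim (M : Submodule ℂ (Fock n)) (q : Fin k → ℕ) : ℕ :=
  opRank (Mᗮ.starProjection ∘L projEq n ℂ q)

lemma finiteDimensional_range_comp {H : Type*} [NormedAddCommGroup H] [InnerProductSpace ℂ H]
    (B : Fock n →L[ℂ] H) {A : Set (Words n)} (hA : A.Finite) :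
    FiniteDimensional ℂ (LinearMap.range (B ∘L wordProj ℂ A).toLinearMap) := by
  have := finiteDimensional_range_wordProj hA
  have h : LinearMap.range (B ∘L wordProj ℂ A).toLinearMap
      = (LinearMap.range (wordProj ℂ A).toLinearMap).map B.toLinearMap :=
    LinearMap.range_comp _ _
  rw [h]
  infer_instance

instance (q : Fin k → ℕ) : FiniteDimensional ℂ (LinearMap.range (projEq n ℂ q).toLinearMap) :=
  finiteDimensional_range_wordProj (finite_deg_eq q)

instance (q : Fin k → ℕ) : FiniteDimensional ℂ (LinearMap.range (projLE n ℂ q).toLinearMap) :=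
  finiteDimensional_range_wordProj (finite_deg_le q)

instance {H : Type*} [NormedAddCommGroup H] [InnerProductSpace ℂ H] (B : Fock n →L[ℂ] H)
    (q : Fin k → ℕ) :
    FiniteDimensional ℂ (LinearMap.range (B ∘L projEq n ℂ q).toLinearMap) :=
  finiteDimensional_range_comp B (finite_deg_eq q)

instance {H : Type*} [NormedAddCommGroup H] [InnerProductSpace ℂ H] (B : Fock n →L[ℂ] H)
    (q : Fin k → ℕ) :
    FiniteDimensional ℂ (LinearMap.range (B ∘L projLE n ℂ q).toLinearMap) :=
  finiteDimensional_range_comp B (finite_deg_le q)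

lemma isStarProjection_comp_projEq (hM : IsClosed (M : Set (Fock n))) (hgr : IsGraded M)
    (q : Fin k → ℕ) : IsStarProjection (Mᗮ.starProjection ∘L projEq n ℂ q) :=
  isStarProjection_starProjection.mul (isStarProjection_wordProj _) (commute_projEq hM hgr q)

lemma isStarProjection_comp_projLE (hM : IsClosed (M : Set (Fock n))) (hgr : IsGraded M)
    (q : Fin k → ℕ) : IsStarProjection (Mᗮ.starProjection ∘L projLE n ℂ q) := by
  refine isStarProjection_starProjection.mul (isStarProjection_wordProj _) ?_
  have : Commute Mᗮ.starProjection (projLE n ℂ q) := by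
    rw [projLE_eq_sum]
    exact Commute.sum_right _ _ _ fun p _ => commute_projEq hM hgr p
  exact this

/-- Ranks of these projections are traces in `e n`, and traces add over degrees. -/
lemma opRank_comp_projLE (hM : IsClosed (M : Set (Fock n))) (hgr : IsGraded M) (q : Fin k → ℕ) :
    opRank (Mᗮ.starProjection ∘L projLE n ℂ q) = ∑ p ∈ Finset.Iic q, homDim M p := by
  have h := hasSum_inner_of_isStarProjection (e n) (isStarProjection_comp_projLE hM hgr q)
  have h' := hasSum_sum (s := Finset.Iic q) fun p _ =>
    hasSum_inner_of_isStarProjection (e n) (isStarProjection_comp_projEq hM hgr p)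
  have h'' := h.unique (h'.congr_fun fun α => by
    simp [projLE_eq_sum, map_sum])
  exact_mod_cast h''

lemma opRank_projLE (q : Fin k → ℕ) :
    opRank (projLE n ℂ q) = ∑ p ∈ Finset.Iic q, ∏ i, n i ^ p i := by
  have h := opRank_comp_projLE (n := n) (M := ⊥) isClosed_singleton
    (fun z f hf => by rw [(Submodule.mem_bot ℂ).1 hf, map_zero]; exact Submodule.zero_mem _) q
  simp only [homDim, Submodule.bot_orthogonal_eq_top, Submodule.starProjection_top',
    ContinuousLinearMap.one_def, ContinuousLinearMap.id_comp, opRank_projEq] at h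
  exact h

lemma mem_range_iff (hM : IsClosed (M : Set (Fock n))) (hgr : IsGraded M) (q : Fin k → ℕ)
    (f : Fock n) : f ∈ LinearMap.range (Mᗮ.starProjection ∘L projEq n ℂ q).toLinearMap ↔
      f ∈ Mᗮ ∧ ∀ α, deg α ≠ q → f α = 0 := by
  constructor
  · rintro ⟨g, rfl⟩
    refine ⟨Submodule.starProjection_apply_mem _ _, fun α hα => ?_⟩
    have h := congrArg (fun A : Fock n →L[ℂ] Fock n => A g) (commute_projEq hM hgr q).eq
    change (Mᗮ.starProjection * projEq n ℂ q) g α = 0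
    rw [show (Mᗮ.starProjection * projEq n ℂ q) g = _ from h, mul_apply_eq_comp, projEq,
      wordProj_apply, Set.indicator_of_notMem (by exact hα)]
  · rintro ⟨hf, hf'⟩
    refine ⟨f, ?_⟩
    have : projEq n ℂ q f = f := by
      ext α
      rw [projEq, wordProj_apply]
      by_cases hα : deg α = q
      · exact Set.indicator_of_mem (by exact hα) _
      · rw [hf' α hα, Set.indicator_of_notMem (by exact hα)]
    change Mᗮ.starProjection (projEq n ℂ q f) = f
    rw [this, Submodule.starProjection_eq_self_iff.2 hf]

lemma deg_consWord (i : Fin k) (j : Fin (n i)) (α : Words n) :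
    deg (consWord i j α) = deg α + Pi.single i 1 := by
  funext l
  by_cases h : l = i
  · subst h; simp [deg, consWord, FreeMonoid.length_mul, add_comm]
  · simp [deg, consWord, h]

/-- Every word of degree `q + e_i` has a nonempty `i`-th component, hence begins there with some
`g_j`; its coefficient in `f` is a coefficient of `S_{i,j}^* f`. So these `n i` vectors of degree
`q` determine `f`. -/
lemma homDim_add_single_le (hM : IsInvariantSubspace M) (hgr : IsGraded M) (q : Fin k → ℕ)
    (i : Fin k) : homDim M (q + Pi.single i 1) ≤ n i * homDim M q := by
  let V (p : Fin k → ℕ) := LinearMap.range (Mᗮ.starProjection ∘L projEq n ℂ p).toLinearMap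
  have hV : ∀ j : Fin (n i), ∀ f ∈ V (q + Pi.single i 1), star (S n i j) f ∈ V q := by
    intro j f hf
    rw [mem_range_iff hM.isClosed hgr] at hf ⊢
    refine ⟨star_S_mem hM i j hf.1, fun α hα => ?_⟩
    rw [star_S_apply]
    refine hf.2 _ fun h => hα ?_
    rw [deg_consWord] at h
    exact add_right_cancel h
  let T : V (q + Pi.single i 1) →ₗ[ℂ] (Fin (n i) → V q) :=
    LinearMap.pi fun j => (star (S n i j)).toLinearMap.restrict (hV j)
  have hT : Function.Injective T := by
    rw [injective_iff_map_eq_zero]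
    intro f hf
    ext α
    by_cases hα : deg α = q + Pi.single i 1
    · rcases eq_one_or_exists_of_mul (α i) with h | ⟨j, w, h⟩
      · have := congrFun hα i
        simp [deg, h] at this
      · have hcons : consWord i j (Function.update α i w) = α := by
          simp [consWord, ← h]
        have h1 : star (S n i j) (f : Fock n) = 0 := congrArg Subtype.val (congrFun hf j)
        rw [← hcons, ← star_S_apply, h1]
        rfl
    · exact ((mem_range_iff hM.isClosed hgr _ _).1 f.2).2 α hα
  have h := LinearMap.finrank_le_finrank_of_injective hT
  rw [Module.finrank_pi_fintype] at h
  simpa [V, homDim, opRank] using h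

/-- The relative dimension `dim (M⊥)_q / dim F_q` of the homogeneous component of degree `q`. -/
def homRatio (M : Submodule ℂ (Fock n)) (q : Fin k → ℕ) : ℝ :=
  homDim M q / ∏ i, (n i : ℝ) ^ q i

lemma homRatio_add_le (hn : ∀ i, 2 ≤ n i) (hM : IsInvariantSubspace M) (hgr : IsGraded M)
    (q : Fin k → ℕ) (N : ℕ) :
    ∀ d : Fin k → ℕ, ∑ i, d i = N → homRatio M (q + d) ≤ homRatio M q := by
  induction N with
  | zero =>
    intro d hd
    have : d = 0 := funext fun i => (Finset.sum_eq_zero_iff.1 hd) i (Finset.mem_univ i)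
    rw [this, add_zero]
  | succ N ih =>
    intro d hd
    obtain ⟨i, hi⟩ : ∃ i, d i ≠ 0 := by
      by_contra! h
      simp [h] at hd
    have hd' : d = (d - Pi.single i 1) + Pi.single i 1 := by
      refine (tsub_add_cancel_of_le fun l => ?_).symm
      by_cases h : l = i
      · subst h; simp; omega
      · simp [h]
    have hs : ∑ l, (d - Pi.single i 1 : Fin k → ℕ) l = N := by
      have h := congrArg (fun d : Fin k → ℕ => ∑ l, d l) hd'
      simp only [Pi.add_apply, Finset.sum_add_distrib, Finset.sum_pi_single', Finset.mem_univ,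
        if_true] at h
      omega
    refine le_trans ?_ (ih _ hs)
    nth_rewrite 1 [hd']
    rw [← add_assoc]
    generalize q + (d - Pi.single i 1) = p
    have hpos : ∀ p : Fin k → ℕ, 0 < ∏ i, (n i : ℝ) ^ p i := fun p =>
      Finset.prod_pos fun i _ => pow_pos (by have := hn i; positivity) _
    have hprod : ∏ l, (n l : ℝ) ^ (p + Pi.single i 1 : Fin k → ℕ) l
        = n i * ∏ l, (n l : ℝ) ^ p l := by
      simp only [Pi.add_apply, pow_add, Finset.prod_mul_distrib]
      rw [mul_comm]
      congr 1
      rw [Finset.prod_eq_single i]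
      · simp
      · intro l _ hl; simp [hl]
      · simp
    have hni : (0 : ℝ) < n i := by have := hn i; positivity
    rw [homRatio, homRatio, hprod, div_le_div_iff₀ (mul_pos hni (hpos p)) (hpos p)]
    have h : (homDim M (p + Pi.single i 1) : ℝ) ≤ n i * homDim M p := by
      exact_mod_cast homDim_add_single_le hM hgr p i
    have := mul_le_mul_of_nonneg_right h (hpos p).le
    linarith

lemma antitone_homRatio (hn : ∀ i, 2 ≤ n i) (hM : IsInvariantSubspace M) (hgr : IsGraded M) :
    Antitone (homRatio M) := fun q q' h => by
  have := homRatio_add_le hn hM hgr q _ (q' - q) rfl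
  rwa [add_tsub_cancel_of_le h] at this

lemma homRatio_nonneg (q : Fin k → ℕ) : 0 ≤ homRatio M q := by
  unfold homRatio; positivity

/-- The weight `∏ n_i ^ p_i` cancels the denominator of `homRatio M p`, leaving the sum of
dimensions. -/
lemma opRank_comp_projLE_div (hn : ∀ i, 2 ≤ n i) (hM : IsClosed (M : Set (Fock n)))
    (hgr : IsGraded M) (q : Fin k → ℕ) :
    (opRank (Mᗮ.starProjection ∘L projLE n ℂ q) : ℝ) /
        ∏ i, ∑ s ∈ Finset.range (q i + 1), (n i : ℝ) ^ s
      = boxAverage (fun i s => (n i : ℝ) ^ s) (homRatio M) q := by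
  rw [opRank_comp_projLE hM hgr, boxAverage, Nat.cast_sum]
  congr 1
  refine Finset.sum_congr rfl fun p _ => ?_
  have hpos : 0 < ∏ i, (n i : ℝ) ^ p i :=
    Finset.prod_pos fun i _ => pow_pos (by have := hn i; positivity) _
  rw [homRatio, mul_div_cancel₀ _ hpos.ne']

lemma opRank_projLE_eq_prod (q : Fin k → ℕ) :
    (opRank (projLE n ℂ q) : ℝ) = ∏ i, ∑ s ∈ Finset.range (q i + 1), (n i : ℝ) ^ s := by
  rw [opRank_projLE, ← sum_Iic_prod]
  push_cast
  rfl

lemma opTrace_projLE (q : Fin k → ℕ) : opTrace (projLE n ℂ q) = opRank (projLE n ℂ q) :=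
  opTrace_of_isStarProjection (isStarProjection_wordProj _)

lemma opTrace_projEq (q : Fin k → ℕ) : opTrace (projEq n ℂ q) = ∏ i, (n i : ℂ) ^ q i := by
  have h := opTrace_of_isStarProjection (A := projEq n ℂ q) (isStarProjection_wordProj _)
  rw [h, opRank_projEq]
  push_cast
  rfl

lemma opTrace_comp_projLE (hM : IsClosed (M : Set (Fock n))) (hgr : IsGraded M) (q : Fin k → ℕ) :
    opTrace (Mᗮ.starProjection ∘L projLE n ℂ q)
      = opRank (Mᗮ.starProjection ∘L projLE n ℂ q) :=
  opTrace_of_isStarProjection (isStarProjection_comp_projLE hM hgr q)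

/-! ### The Euler characteristic of the compression -/

/-- The defect has range spanned by the projected vacuum, and the word `α` in the compression sends
that vector to the projection of `e n α`. -/
lemma map_degSpan_compression (hM : IsInvariantSubspace M) (q : Fin k → ℕ) :
    (degSpan (compression M) q).map Mᗮ.subtype
      = LinearMap.range (Mᗮ.starProjection ∘L projLE n ℂ q).toLinearMap := by
  apply le_antisymm
  · rw [degSpan, Submodule.map_span_le]
    rintro _ ⟨α, hα, f, rfl⟩
    rw [defect_compression_apply hM, map_smul, prod_wordOp_compression_e hM, map_smul]
    refine Submodule.smul_mem _ _ ⟨e n α, ?_⟩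
    have : projLE n ℂ q (e n α) = e n α := by
      ext β
      rw [projLE, wordProj_apply]
      by_cases hβ : β = α
      · subst hβ; exact Set.indicator_of_mem (by exact hα) _
      · rw [e_apply_ne hβ]; simp [e_apply_ne hβ]
    change Mᗮ.starProjection (projLE n ℂ q (e n α)) = _
    rw [this]
    rfl
  · have he : ∀ α, deg α ≤ q →
        Mᗮ.orthogonalProjectionOnto (e n α) ∈ degSpan (compression M) q := by
      intro α hα
      let h : Mᗮ := Mᗮ.orthogonalProjectionOnto (e n 1)
      -- If the vacuum lies in `M`, every projected basis vector vanishes, being the image of zero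
      -- under a word. Otherwise the defect scales `h` by its vacuum coefficient `⟨h, h⟩ ≠ 0`, so
      -- `h` is in its range.
      by_cases h0 : h = 0
      · rw [← prod_wordOp_compression_e hM]
        change _ ∈ _
        rw [show Mᗮ.orthogonalProjectionOnto (e n 1) = 0 from h0, map_zero]
        exact Submodule.zero_mem _
      · have hc : (h : Fock n) 1 ≠ 0 := by
          have : (h : Fock n) 1 = inner ℂ h h := by
            rw [← inner_e, Submodule.coe_inner]
            exact (Submodule.inner_starProjection_left_eq_right Mᗮ (e n 1) (h : Fock n)).symm ▸
              (by rw [Submodule.starProjection_eq_self_iff.2 h.2])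
          rw [this]
          exact inner_self_ne_zero.2 h0
        have : Mᗮ.orthogonalProjectionOnto (e n α) = ((h : Fock n) 1)⁻¹ •
            (List.ofFn fun i => wordOp (compression M) i (α i)).prod
              (defect (compression M) h) := by
          rw [defect_compression_apply hM, map_smul, prod_wordOp_compression_e hM, smul_smul,
            inv_mul_cancel₀ hc, one_smul]
        rw [this]
        exact Submodule.smul_mem _ _ (Submodule.subset_span ⟨α, hα, h, rfl⟩)
    rintro _ ⟨f, rfl⟩
    have hsum : projLE n ℂ q f = ∑ α ∈ (finite_deg_le (n := n) q).toFinset, f α • e n α := by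
      classical
      ext β
      rw [projLE, wordProj_apply, lp.coeFn_sum, Finset.sum_apply]
      have : ∀ α, (f α • e n α : Fock n) β = if β = α then f α else 0 := by
        intro α
        rw [lp.coeFn_smul, Pi.smul_apply]
        split_ifs with h
        · subst h; simp [e_apply_self]
        · simp [e_apply_ne h]
      simp only [this, Finset.sum_ite_eq, Set.Finite.mem_toFinset, Set.indicator_apply]
    change Mᗮ.starProjection (projLE n ℂ q f) ∈ _
    rw [hsum, map_sum]
    refine Submodule.sum_mem _ fun α hα => ?_
    rw [map_smul]
    exact Submodule.smul_mem _ _ ⟨_, he α ((finite_deg_le q).mem_toFinset.1 hα), rfl⟩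

lemma finrank_degSpan_compression (hM : IsInvariantSubspace M) (q : Fin k → ℕ) :
    Module.finrank ℂ (degSpan (compression M) q)
      = opRank (Mᗮ.starProjection ∘L projLE n ℂ q) := by
  rw [opRank, ← map_degSpan_compression hM]
  exact (LinearEquiv.finrank_eq (Submodule.equivMapOfInjective _ Mᗮ.injective_subtype _))

lemma hasEulerCharacteristic_compression (hn : ∀ i, 2 ≤ n i) (hM : IsInvariantSubspace M)
    (hgr : IsGraded M) {c : ℝ} (hc : IsGLB (Set.range (homRatio M)) c) :
    HasEulerCharacteristic (compression M) c := by
  intro q hq hcof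
  simp only [finrank_degSpan_compression hM, opRank_comp_projLE_div hn hM.isClosed hgr]
  exact (tendsto_boxAverage (fun i s => one_le_pow₀ (by have := hn i; exact_mod_cast (by omega)))
    (antitone_homRatio hn hM hgr) hc).comp (tendsto_atTop_atTop_of_monotone hq hcof)

end Dimensions

/-! ### The Berezin kernel and the curvature of the compression -/

section BerezinCoord

variable {k : ℕ} {n : Fin k → ℕ}
variable {H : Type*} [NormedAddCommGroup H] [InnerProductSpace ℂ H] [CompleteSpace H]

/-- The `β`-th coordinate `Δ_X(I)^{1/2} X_{1,β₁}^* ⋯ X_{k,β_k}^*` of the Berezin kernel. -/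
def berezinCoord (X : Tuple n H) (β : Words n) : H →L[ℂ] H :=
  CFC.sqrt (defect X) * (List.ofFn fun i => star (wordOp X i (β i))).prod

lemma isBerezinKernel_iff {X : Tuple n H} {K : H →L[ℂ] FockTensor n H} :
    IsBerezinKernel X K ↔ ∀ h β, K h β = berezinCoord X β h := Iff.rfl

lemma inner_sqrt_apply {A : H →L[ℂ] H} (hA : A.IsPositive) (f g : H) :
    inner ℂ (CFC.sqrt A f) (CFC.sqrt A g) = inner ℂ f (A g) := by
  have hsa : star (CFC.sqrt A) = CFC.sqrt A :=
    (IsSelfAdjoint.of_nonneg (CFC.sqrt_nonneg A)).star_eq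
  rw [← ContinuousLinearMap.adjoint_inner_right, ← ContinuousLinearMap.star_eq_adjoint, hsa,
    ← mul_apply_eq_comp,
    CFC.sqrt_mul_sqrt_self _ ((ContinuousLinearMap.nonneg_iff_isPositive _).2 hA)]

lemma inner_berezinCoord {X : Tuple n H} (hX : InPolyball X) (β : Words n) (f g : H) :
    inner ℂ (berezinCoord X β f) (berezinCoord X β g)
      = inner ℂ ((List.ofFn fun i => star (wordOp X i (β i))).prod f)
        (defect X ((List.ofFn fun i => star (wordOp X i (β i))).prod g)) :=
  inner_sqrt_apply (hX.positive _ fun _ => le_rfl) _ _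

end BerezinCoord

section Curvature

variable {k : ℕ} {n : Fin k → ℕ} {M : Submodule ℂ (Fock n)}

/-- In an inner product the two square roots recombine to the defect, which sees only vacuum
coefficients; the one of the adjoint word `β` applied to `f` is `f β`. The square root is never
computed. -/
lemma inner_berezinCoord_compression (hM : IsInvariantSubspace M) (β : Words n) (f g : Mᗮ) :
    inner ℂ (berezinCoord (compression M) β f) (berezinCoord (compression M) β g)
      = inner ℂ ((f : Fock n) β) ((g : Fock n) β) := by
  rw [inner_berezinCoord (inPolyball_compression hM), defect_compression_apply hM,
    inner_smul_right, Submodule.coe_inner, Submodule.coe_orthogonalProjectionOnto_apply,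
    ← Submodule.inner_starProjection_left_eq_right,
    Submodule.starProjection_eq_self_iff.2 (Subtype.prop _), ← inner_conj_symm, inner_e,
    prod_star_wordOp_compression_apply_one hM, prod_star_wordOp_compression_apply_one hM,
    RCLike.inner_apply]

lemma norm_berezinCoord_compression (hM : IsInvariantSubspace M) (β : Words n) (f : Mᗮ) :
    ‖berezinCoord (compression M) β f‖ = ‖(f : Fock n) β‖ := by
  rw [@norm_eq_sqrt_re_inner ℂ, inner_berezinCoord_compression hM, ← @norm_eq_sqrt_re_inner ℂ]

lemma exists_isBerezinKernel_compression (hM : IsInvariantSubspace M) :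
    ∃ K, IsBerezinKernel (compression M) K := by
  have hF : ∀ f, Memℓp (fun β => berezinCoord (compression M) β f) 2 := fun f => by
    refine memℓp_gen ?_
    simp only [norm_berezinCoord_compression hM]
    exact (memℓp_gen_iff (by norm_num)).1 (f : Fock n).2
  let K : Mᗮ →ₗ[ℂ] FockTensor n Mᗮ :=
    { toFun := fun f => ⟨fun β => berezinCoord (compression M) β f, hF f⟩
      map_add' := fun f g => by ext1; funext β; exact map_add _ f g
      map_smul' := fun a f => by ext1; funext β; exact map_smul _ a f }
  refine ⟨K.mkContinuous 1 fun f => ?_, isBerezinKernel_iff.2 fun f β => rfl⟩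
  have h : ‖K f‖ = ‖(f : Fock n)‖ := by
    rw [lp.norm_eq_tsum_rpow (by norm_num), lp.norm_eq_tsum_rpow (by norm_num)]
    congr 1
    refine tsum_congr fun β => ?_
    exact congrArg (· ^ _) (norm_berezinCoord_compression hM β f)
  rw [h, one_mul]
  rfl

lemma isBerezinKernel_berezinKernel (hM : IsInvariantSubspace M) :
    IsBerezinKernel (compression M) (berezinKernel (compression M)) := by
  have h := exists_isBerezinKernel_compression hM
  rw [berezinKernel, dif_pos h]
  exact h.choose_spec

/-- Coordinatewise preservation of inner products makes both quadratic forms the same sum over words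
of degree `q`. -/
lemma berezinKernel_conj_projEq (hM : IsInvariantSubspace M) (q : Fin k → ℕ) :
    (berezinKernel (compression M)).adjoint ∘L projEq n Mᗮ q ∘L berezinKernel (compression M)
      = compress M (projEq n ℂ q) := by
  have hK := isBerezinKernel_iff.1 (isBerezinKernel_berezinKernel hM)
  ext1 f
  refine ext_inner_left ℂ fun g => ?_
  rw [ContinuousLinearMap.comp_apply, ContinuousLinearMap.adjoint_inner_right,
    ContinuousLinearMap.comp_apply, compress_apply, Submodule.coe_inner,
    Submodule.coe_orthogonalProjectionOnto_apply, ← Submodule.inner_starProjection_left_eq_right,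
    Submodule.starProjection_eq_self_iff.2 g.2, lp.inner_eq_tsum, lp.inner_eq_tsum]
  refine tsum_congr fun β => ?_
  rw [projEq, projEq, wordProj_apply, wordProj_apply]
  by_cases hβ : deg β = q
  · rw [Set.indicator_of_mem (by exact hβ), Set.indicator_of_mem (by exact hβ), hK, hK,
      inner_berezinCoord_compression hM]
  · rw [Set.indicator_of_notMem (by exact hβ), Set.indicator_of_notMem (by exact hβ),
      inner_zero_right, inner_zero_right]

lemma projEq_mem_orthogonal (hM : IsClosed (M : Set (Fock n))) (hgr : IsGraded M)
    (q : Fin k → ℕ) (f : Mᗮ) : projEq n ℂ q f ∈ Mᗮ := by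
  have h := congrArg (fun A : Fock n →L[ℂ] Fock n => A f) (commute_projEq hM hgr q).eq
  simp only [mul_apply_eq_comp, Submodule.starProjection_eq_self_iff.2 f.2] at h
  exact Submodule.starProjection_eq_self_iff.1 h

lemma coe_compress_projEq (hM : IsClosed (M : Set (Fock n))) (hgr : IsGraded M)
    (q : Fin k → ℕ) (f : Mᗮ) :
    (compress M (projEq n ℂ q) f : Fock n) = projEq n ℂ q f :=
  Submodule.starProjection_eq_self_iff.2 (projEq_mem_orthogonal hM hgr q f)

lemma isStarProjection_compress_projEq (hM : IsClosed (M : Set (Fock n))) (hgr : IsGraded M)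
    (q : Fin k → ℕ) : IsStarProjection (compress M (projEq n ℂ q)) where
  isIdempotentElem := by
    ext1 f
    refine Subtype.ext ?_
    rw [mul_apply_eq_comp, coe_compress_projEq hM hgr, coe_compress_projEq hM hgr]
    exact congrArg (fun A : Fock n →L[ℂ] Fock n => A f)
      (isStarProjection_wordProj (G := ℂ) _).isIdempotentElem
  isSelfAdjoint := by
    rw [IsSelfAdjoint, star_compress, projEq, (isStarProjection_wordProj (G := ℂ) _).isSelfAdjoint.star_eq]

lemma map_range_compress_projEq (hM : IsClosed (M : Set (Fock n))) (hgr : IsGraded M)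
    (q : Fin k → ℕ) :
    (LinearMap.range (compress M (projEq n ℂ q)).toLinearMap).map Mᗮ.subtype
      = LinearMap.range (Mᗮ.starProjection ∘L projEq n ℂ q).toLinearMap := by
  ext f
  constructor
  · rintro ⟨_, ⟨g, rfl⟩, rfl⟩
    exact ⟨g, rfl⟩
  · intro hf
    obtain ⟨g, rfl⟩ := hf
    refine ⟨_, ⟨Mᗮ.orthogonalProjectionOnto g, rfl⟩, ?_⟩
    change ((compress M (projEq n ℂ q) (Mᗮ.orthogonalProjectionOnto g) : Mᗮ) : Fock n) = _
    rw [coe_compress_projEq hM hgr, Submodule.coe_orthogonalProjectionOnto_apply]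
    exact congrArg (fun A : Fock n →L[ℂ] Fock n => A g) (commute_projEq hM hgr q).eq.symm

lemma curvatureTerm_compression (hM : IsInvariantSubspace M) (hgr : IsGraded M)
    (q : Fin k → ℕ) : curvatureTerm (compression M) q = (homRatio M q : ℂ) := by
  have hequiv := Submodule.equivMapOfInjective Mᗮ.subtype Mᗮ.injective_subtype
    (LinearMap.range (compress M (projEq n ℂ q)).toLinearMap)
  rw [map_range_compress_projEq hM.isClosed hgr] at hequiv
  have : FiniteDimensional ℂ (LinearMap.range (compress M (projEq n ℂ q)).toLinearMap) :=
    Module.Finite.equiv hequiv.symm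
  have hrank : opRank (compress M (projEq n ℂ q)) = homDim M q := hequiv.finrank_eq
  rw [curvatureTerm, berezinKernel_conj_projEq hM,
    opTrace_of_isStarProjection (isStarProjection_compress_projEq hM.isClosed hgr q), hrank,
    opTrace_projEq, homRatio]
  push_cast
  rfl

lemma hasCurvature_compression (hn : ∀ i, 2 ≤ n i) (hM : IsInvariantSubspace M)
    (hgr : IsGraded M) {c : ℝ} (hc : IsGLB (Set.range (homRatio M)) c) :
    HasCurvature (compression M) c := by
  have h := (Complex.continuous_ofReal.tendsto c).comp
    (tendsto_simplex_average (antitone_homRatio hn hM hgr) hc)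
  refine h.congr fun m => ?_
  simp only [curvatureTerm_compression hM hgr, Function.comp_apply]
  push_cast
  rfl

end Curvature

end Polyball

end

theorem mainTheorem6 {k : ℕ} {n : Fin k → ℕ} (hk : 1 ≤ k) (hn : ∀ i, 2 ≤ n i)
    (M : Submodule ℂ (Polyball.Fock n)) (hM : Polyball.IsInvariantSubspace M)
    (hgr : Polyball.IsGraded M) :
    Polyball.InPolyball (Polyball.compression M) ∧
    Polyball.HasFiniteRankDefect (Polyball.compression M) ∧
    ∃ c : ℝ,
      Polyball.HasIteratedLimit k
        (fun q => (Polyball.opRank (Mᗮ.starProjection ∘L Polyball.projLE n ℂ q) : ℝ) /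
          (Polyball.opRank (Polyball.projLE n ℂ q) : ℝ)) c ∧
      Polyball.HasIteratedLimit k
        (fun q => Polyball.opTrace (Mᗮ.starProjection ∘L Polyball.projLE n ℂ q) /
          Polyball.opTrace (Polyball.projLE n ℂ q)) (c : ℂ) ∧
      Polyball.HasEulerCharacteristic (Polyball.compression M) c ∧
      Polyball.HasCurvature (Polyball.compression M) c := by
  -- The common value of all the limits is the infimum of the relative dimensions.
  have hc : IsGLB (Set.range (Polyball.homRatio M)) (⨅ q, Polyball.homRatio M q) :=
    isGLB_ciInf ⟨0, by rintro _ ⟨q, rfl⟩; exact Polyball.homRatio_nonneg q⟩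
  have hlim : Polyball.HasIteratedLimit k
      (fun q => (Polyball.opRank (Mᗮ.starProjection ∘L Polyball.projLE n ℂ q) : ℝ) /
        (Polyball.opRank (Polyball.projLE n ℂ q) : ℝ)) (⨅ q, Polyball.homRatio M q) := by
    simp only [Polyball.opRank_projLE_eq_prod, Polyball.opRank_comp_projLE_div hn hM.isClosed hgr]
    exact Polyball.hasIteratedLimit_boxAverage
      (fun i s => one_le_pow₀ (by have := hn i; exact_mod_cast (by omega)))
      (Polyball.antitone_homRatio hn hM hgr) hc
  refine ⟨Polyball.inPolyball_compression hM, Polyball.hasFiniteRankDefect_compression hM, _, hlim,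
    ?_, Polyball.hasEulerCharacteristic_compression hn hM hgr hc,
    Polyball.hasCurvature_compression hn hM hgr hc⟩
  -- Traces equal ranks for each `q`, so the trace quotient is the complex cast of the rank
  -- quotient.
  simpa [Polyball.opTrace_comp_projLE hM.isClosed hgr, Polyball.opTrace_projLE] using hlim.ofReal
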